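/- **Definitions.** Let $M,n\ge 2$. Write $\bigwedge^k\mathbb R^n$ for the space of $k$-forms on $\mathbb R^n$ with constant coefficients, let $\star$ be the Hodge star, normalised by $dx^\alpha\wedge\star dx^\alpha=dx^1\wedge\dots\wedge dx^n$, and let wedge products act componentwise on $\mathbb R^M$-valued forms. Put $E=(\mathbb R^M\otimes\bigwedge^1\mathbb R^n)\times(\mathbb R^M\otimes\bigwedge^{n-1}\mathbb R^n)$; for $(X,Y)\in E$ identify $X$ with its $M\times n$ coefficient matrix. A function $F:\mathbb R^{M\times n}\to\mathbb R$ is *polyconvex* if $F(X)$ is a (finite) convex function of the vector of all $\ell\times\ell$ subdeterminants of $X$, $1\le\ell\le\min\{M,n\}$; it is *strongly polyconvex* if $F(X)-\gamma|X|^2$ is polyconvex for some $\gamma>0$. For differentiable $F$ let $$K_F=\Big\{(X,Y)\in E:\ Y^i=\sum_{\alpha=1}^n\frac{\partial F}{\partial X_{i\alpha}}(X)\,\star dx^\alpha,\ i=1,\dots,M\Big\}.$$ Let $\mathscr R\subset E$ be the set of all $\sum_{\alpha}b_\alpha dx^\alpha\wedge a$ with $b\in\mathbb R^n$ and $a=(a',a'')\in\mathbb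 R^M\times(\mathbb R^M\otimes\bigwedge^{n-2}\mathbb R^n)$, and let $\mathscr R^o$ be the set of those given by some $b\neq0$ and some $a$ with $a'\ne0$. A *$T_N$-configuration* consists of $P\in E$, $C_1,\dots,C_N\in\mathscr R$ with $\sum_iC_i=0$, and $\kappa_1,\dots,\kappa_N\in(1,\infty)$. Its *endpoints* are $Z_k=(X_k,Y_k)=P+C_1+\dots+C_{k-1}+\kappa_kC_k$. It is *non-degenerate* if 1. $C_i\in\mathscr R^o$ for all $i$; 2. whenever $C_i=\sum_\alpha b^i_\alpha dx^\alpha\wedge a^i$ with $|b^i|=1$ and $(a^i)'\neq0$ for $i=1,\dots,N$, then $b^1,\dots,b^N$ span $\mathbb R^n$ and, for every $i$ (indices modulo $N$), the vectors $b^i,b^{i+1}$ are linearly independent and the vectors $(a^i)',(a^{i+1})'$ are linearly independent; 3. $Z_k-Z_l\notin\mathscr R$ for all $k\ne l$. It is *wild* if for every $\beta\in\{1,\dots,n\}$ the set $\{X_ke_\beta:\ k=1,\dots,N\}\subset\mathbb R^M$ has at least two elements. **Theorem.** For all $M,n\ge2$ and $N_0\in\mathbb N$ there exist $N\ge N_0$,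 a smooth, strongly polyconvex function $F:\mathbb R^{M\times n}\to\mathbb R$ and a non-degenerate, wild $T_N$-configuration with endpoints $Z_k=(X_k,Y_k)$, such that $Z_k\in K_F$ and $D^2F(X_k)$ is positive definite for every $k\in\{1,\dots,N\}$. -/

import Mathlib

open scoped Matrix.Norms.Frobenius ContDiff

noncomputable section

namespace PolyconvexTN

/-! ### Polyconvexity -/

/-- Index set of all square minors of an `M × n` matrix, of all sizes `k + 1 ∈ {1, …, min M n}`:
increasing choices of `k + 1` rows and of `k + 1` columns. -/
abbrev MinorIndex (M n : ℕ) : Type :=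
  Σ k : Fin (min M n), (Fin (k + 1) ↪o Fin M) × (Fin (k + 1) ↪o Fin n)

/-- The vector of all subdeterminants of `X` (the `1 × 1` ones are the entries of `X`). -/
def minors {M n : ℕ} (X : Matrix (Fin M) (Fin n) ℝ) : MinorIndex M n → ℝ :=
  fun s => (X.submatrix s.2.1 s.2.2).det

/-- `F` is a convex function of the subdeterminants. -/
def Polyconvex {M n : ℕ} (F : Matrix (Fin M) (Fin n) ℝ → ℝ) : Prop :=
  ∃ G : (MinorIndex M n → ℝ) → ℝ, ConvexOn ℝ Set.univ G ∧ ∀ X, F X = G (minors X)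

/-- `F(X) - γ |X|²` is polyconvex for some `γ > 0`, with `|X|²` the sum of the squared entries. -/
def StronglyPolyconvex {M n : ℕ} (F : Matrix (Fin M) (Fin n) ℝ → ℝ) : Prop :=
  ∃ γ : ℝ, 0 < γ ∧ Polyconvex fun X => F X - γ * ∑ i, ∑ α, X i α ^ 2

/-- The partial derivative `∂F/∂X_{iα}` at `X`. -/
def partialDeriv {M n : ℕ} (F : Matrix (Fin M) (Fin n) ℝ → ℝ) (X : Matrix (Fin M) (Fin n) ℝ)
    (i : Fin M) (α : Fin n) : ℝ :=
  fderiv ℝ F X (Matrix.single i α 1)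

/-- The quadratic form `D²F(X)` is positive definite. -/
def HessianPosDef {M n : ℕ} (F : Matrix (Fin M) (Fin n) ℝ → ℝ)
    (X : Matrix (Fin M) (Fin n) ℝ) : Prop :=
  ∀ H : Matrix (Fin M) (Fin n) ℝ, H ≠ 0 → 0 < fderiv ℝ (fderiv ℝ F) X H H

/-! ### Differential forms with constant coefficients

Forms live in the exterior algebra of the space `Fin n → ℝ` of coefficient vectors of one-forms:
`b : Fin n → ℝ` stands for `∑ α, b α dx^α`, and the wedge product is the product of the algebra. -/

/-- The space of `k`-forms on `ℝ^n`. -/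
abbrev Form (n k : ℕ) : Type := ⋀[ℝ]^k (Fin n → ℝ)

/-- The one-form `dx^α`, as a coefficient vector. -/
def dx {n : ℕ} (α : Fin n) : Fin n → ℝ := Pi.single α 1

lemma card_compl_singleton {n : ℕ} (α : Fin n) : ({α}ᶜ : Finset (Fin n)).card = n - 1 := by
  simp [Finset.card_compl]

/-- The Hodge dual `⋆dx^α = (-1)^α dx^0 ∧ … ∧ dx^{α-1} ∧ dx^{α+1} ∧ … ∧ dx^{n-1}`, the indices
being counted from `0`; the sign is the one for which `dx^α ∧ ⋆dx^α = dx^0 ∧ … ∧ dx^{n-1}`. -/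
def starDx {n : ℕ} (α : Fin n) : Form n (n - 1) :=
  (-1 : ℝ) ^ (α : ℕ) • exteriorPower.ιMulti ℝ (n - 1)
    (fun j => dx (({α}ᶜ : Finset (Fin n)).orderEmbOfFin (card_compl_singleton α) j))

/-- The space of pairs `(X, Y)` of an `ℝ^M`-valued one-form and an `ℝ^M`-valued
`(n - 1)`-form. -/
abbrev FormPair (M n : ℕ) : Type := (Fin M → Form n 1) × (Fin M → Form n (n - 1))

/-- The `M × n` matrix of coefficients of an `ℝ^M`-valued one-form. -/
def toMatrix {M n : ℕ} (X : Fin M → Form n 1) : Matrix (Fin M) (Fin n) ℝ :=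
  Matrix.of fun i α => exteriorPower.oneEquiv ℝ (Fin n → ℝ) (X i) α

/-- The set `K_F` of all `(X, Y)` with `Y^i = ∑ α, ∂F/∂X_{iα}(X) ⋆dx^α`. -/
def setK {M n : ℕ} (F : Matrix (Fin M) (Fin n) ℝ → ℝ) : Set (FormPair M n) :=
  {Z | ∀ i, Z.2 i = ∑ α, partialDeriv F (toMatrix Z.1) i α • starDx α}

/-! ### `𝓡`-connections and `T_N`-configurations -/

/-- `C = (∑ α, b α dx^α) ∧ a` for `a = (a', a'')`, with `a'` an `ℝ^M`-valued zero-form and `a''` an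
`ℝ^M`-valued `(n - 2)`-form (meant for `2 ≤ n`). -/
def IsWedge {M n : ℕ} (C : FormPair M n) (b : Fin n → ℝ) (a' : Fin M → ℝ)
    (a'' : Fin M → Form n (n - 2)) : Prop :=
  (∀ i, (C.1 i : ExteriorAlgebra ℝ (Fin n → ℝ)) =
      ExteriorAlgebra.ι ℝ b * algebraMap ℝ (ExteriorAlgebra ℝ (Fin n → ℝ)) (a' i)) ∧
  (∀ i, (C.2 i : ExteriorAlgebra ℝ (Fin n → ℝ)) =
      ExteriorAlgebra.ι ℝ b * (a'' i : ExteriorAlgebra ℝ (Fin n → ℝ)))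

/-- The set `𝓡`, which replaces the matrices of rank at most one. -/
def setR (M n : ℕ) : Set (FormPair M n) :=
  {C | ∃ b a' a'', IsWedge C b a' a''}

/-- The set `𝓡°` of the elements of `𝓡` given by some `b ≠ 0` and some `a` with `a' ≠ 0`. -/
def setRo (M n : ℕ) : Set (FormPair M n) :=
  {C | ∃ b a' a'', b ≠ 0 ∧ a' ≠ 0 ∧ IsWedge C b a' a''}

/-- A `T_N`-configuration. -/
structure TConfig (M n N : ℕ) where
  P : FormPair M n
  C : Fin N → FormPair M n
  κ : Fin N → ℝ
  mem_setR : ∀ i, C i ∈ setR M n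
  sum_eq_zero : ∑ i, C i = 0
  one_lt : ∀ i, 1 < κ i

namespace TConfig

variable {M n N : ℕ}

/-- The endpoint `Z_k = P + C_1 + … + C_{k-1} + κ_k C_k`. -/
def endpoint (T : TConfig M n N) (k : Fin N) : FormPair M n :=
  T.P + ∑ j ∈ Finset.Iio k, T.C j + T.κ k • T.C k

/-- The matrix `X_k` of the upper component of the endpoint `Z_k = (X_k, Y_k)`. -/
def endMatrix (T : TConfig M n N) (k : Fin N) : Matrix (Fin M) (Fin n) ℝ :=
  toMatrix (T.endpoint k).1

/-- Non-degeneracy; `finRotate N` is the cyclic successor on the indices. -/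
structure NonDegenerate (T : TConfig M n N) : Prop where
  mem_setRo : ∀ i, T.C i ∈ setRo M n
  span_and_indep : ∀ (b : Fin N → Fin n → ℝ) (a' : Fin N → Fin M → ℝ)
    (a'' : Fin N → Fin M → Form n (n - 2)),
    (∀ i, ∑ α, b i α ^ 2 = 1) → (∀ i, a' i ≠ 0) → (∀ i, IsWedge (T.C i) (b i) (a' i) (a'' i)) →
      Submodule.span ℝ (Set.range b) = ⊤ ∧
      (∀ i, LinearIndependent ℝ ![b i, b (finRotate N i)]) ∧
      (∀ i, LinearIndependent ℝ ![a' i, a' (finRotate N i)])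
  sub_notMem_setR : ∀ k l, k ≠ l → T.endpoint k - T.endpoint l ∉ setR M n

/-- For each `β` the vectors `X_k e_β`, `k = 1, …, N`, are not all equal. -/
def Wild (T : TConfig M n N) : Prop :=
  ∀ β : Fin n, ∃ k l : Fin N,
    (fun i => T.endMatrix k i β) ≠ fun i => T.endMatrix l i β

end TConfig

end PolyconvexTN

end

/-! Gradients `Y k` at points `X k` are interpolated by a polyconvex function once there are values
`c k` and determinant coefficients `d k` with `c k + ⟨Y k, X l - X k⟩ + d k * det (X l - X k) < c l`
for all `k ≠ l`, where `det` is one fixed 2 × 2 minor. Indeed each left side is polyaffine in `X l`,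
and a smooth maximum of slightly convexified copies does the job (`exists_stronglyPolyconvex`). The
convexification adds `|d|·|H|²` to the Hessian at the contact point, which dominates the indefinite
form of the determinant, but it is uniformly small on finite sets.

It remains to find configurations satisfying these strict inequalities. In the 2 × 2 case the edges
are `a ⊗ b` above and `w ⊗ perp b` below. An explicit `pentagon` starts an induction on the number
of edges (`PlanarConfig.exists_succ`): the last edge is halved and the second half is bent by `ε`.
At `ε = 0` both new endpoints coincide with the old one, so the old inequalities survive for small
`ε`. The inequalities between the two new endpoints hold by `bending_identity`, whose free parameter
`q` makes the bending monotone. The first two edges, with right factors `e₁` and `e₂`, absorb the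
closing error.

For general `M` and `n`, the left factors are padded by zeros and the right factors are extended so
as to span `ℝ^n` while keeping the polygon closed (`Extension.nonempty`); this is possible when
there are enough edges. The lower endpoints live in the first 2 × 2 block, so the inequalities are
unchanged. Adding the inequalities for `(k, l)` and `(l, k)` also excludes `Z_k - Z_l ∈ 𝓡`, because
there both the pairing and the minor vanish. -/

noncomputable section

namespace PolyconvexTN

open Matrix Filter Topology

/-! ### Planar configurations and their strict inequalities. -/

/-- Rotation of a planar vector by a right angle. -/
def perp (b : Fin 2 → ℝ) : Fin 2 → ℝ := ![-b 1, b 0]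

lemma perp_zero (b : Fin 2 → ℝ) : perp b 0 = -b 1 := rfl

lemma perp_one (b : Fin 2 → ℝ) : perp b 1 = b 0 := rfl

/-- The determinant of a pair of planar vectors. -/
def cross (u v : Fin 2 → ℝ) : ℝ := u 0 * v 1 - u 1 * v 0

/-- The `k`-th endpoint of the polygon with edges `v j ⊗ b j` starting at the origin. -/
def corner {ι ι' : Type*} (κ : ℕ → ℝ) (v : ℕ → ι → ℝ) (b : ℕ → ι' → ℝ) (k : ℕ) : Matrix ι ι' ℝ :=
  ∑ j ∈ Finset.range k, vecMulVec (v j) (b j) + κ k • vecMulVec (v k) (b k)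

/-- The Frobenius inner product of `2 × 2` matrices. -/
def pairing (Y X : Matrix (Fin 2) (Fin 2) ℝ) : ℝ := ∑ i, ∑ α, Y i α * X i α

/-- The excess of `c'` at `X'` over the polyaffine function with value `c`, gradient `Y` and
determinant coefficient `d` at `X`. -/
def gap (c d : ℝ) (X Y : Matrix (Fin 2) (Fin 2) ℝ) (c' : ℝ) (X' : Matrix (Fin 2) (Fin 2) ℝ) : ℝ :=
  c' - c - pairing Y (X' - X) - d * (X' - X).det

lemma corner_apply {ι ι' : Type*} (κ : ℕ → ℝ) (v : ℕ → ι → ℝ) (b : ℕ → ι' → ℝ) (k : ℕ) (i : ι)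
    (α : ι') :
    corner κ v b k i α = ∑ j ∈ Finset.range k, v j i * b j α + κ k * (v k i * b k α) := by
  simp [corner, vecMulVec_apply, Matrix.sum_apply]

lemma gap_eq (c d : ℝ) (X Y : Matrix (Fin 2) (Fin 2) ℝ) (c' : ℝ) (X' : Matrix (Fin 2) (Fin 2) ℝ) :
    gap c d X Y c' X' = c' - c - (Y 0 0 * (X' 0 0 - X 0 0) + Y 0 1 * (X' 0 1 - X 0 1) +
      (Y 1 0 * (X' 1 0 - X 1 0) + Y 1 1 * (X' 1 1 - X 1 1))) -
      d * ((X' 0 0 - X 0 0) * (X' 1 1 - X 1 1) - (X' 0 1 - X 0 1) * (X' 1 0 - X 1 0)) := by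
  simp [gap, pairing, Fin.sum_univ_two, det_fin_two]

/-- A planar configuration with `m + 1` endpoints which satisfies the strict inequalities for
interpolation by a polyconvex function. -/
structure PlanarConfig (m : ℕ) where
  a : ℕ → Fin 2 → ℝ
  w : ℕ → Fin 2 → ℝ
  b : ℕ → Fin 2 → ℝ
  κ : ℕ → ℝ
  c : ℕ → ℝ
  d : ℕ → ℝ
  b_zero : b 0 = ![1, 0]
  b_one : b 1 = ![0, 1]
  one_lt : ∀ j ≤ m, 1 < κ j
  sum_a : ∑ j ∈ Finset.range (m + 1), vecMulVec (a j) (b j) = 0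
  sum_w : ∑ j ∈ Finset.range (m + 1), vecMulVec (w j) (b j) = 0
  cross_a : ∀ j < m, cross (a j) (a (j + 1)) ≠ 0
  cross_a_last : cross (a m) (a 0) ≠ 0
  cross_b : ∀ j < m, cross (b j) (b (j + 1)) ≠ 0
  cross_b_last : cross (b m) (b 0) ≠ 0
  gap_pos : ∀ k ≤ m, ∀ l ≤ m, k ≠ l →
    0 < gap (c k) (d k) (corner κ a b k) (corner κ w (fun j => perp (b j)) k)
      (c l) (corner κ a b l)

/-! ### The explicit five-point configuration. -/

/-- The left factors of the upper edges of `pentagon`. -/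
def pentagonA : ℕ → Fin 2 → ℝ
  | 0 => ![-1, -1]
  | 1 => ![1, -1]
  | 2 => ![0, -1]
  | 3 => ![-1, 0]
  | _ => ![0, 1]

/-- The left factors of the lower edges of `pentagon`. -/
def pentagonW : ℕ → Fin 2 → ℝ
  | 0 => ![1, -10]
  | 1 => ![-17, 0]
  | 2 => ![-9, -8]
  | 3 => ![10, -2]
  | _ => ![7, 2]

/-- The right factors of the edges of `pentagon`. -/
def pentagonB : ℕ → Fin 2 → ℝ
  | 0 => ![1, 0]
  | 1 => ![0, 1]
  | 2 => ![-1, 0]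
  | 3 => ![-1, 1]
  | _ => ![0, 1]

/-- The upper endpoints of `pentagon`. -/
def pentagonX : ℕ → Matrix (Fin 2) (Fin 2) ℝ
  | 0 => !![-2, 0; -2, 0]
  | 1 => !![-1, 2; -1, -2]
  | 2 => !![-1, 1; 1, -1]
  | 3 => !![1, -1; 0, -1]
  | _ => !![0, 0; 0, 1]

/-- The lower endpoints of `pentagon`. -/
def pentagonY : ℕ → Matrix (Fin 2) (Fin 2) ℝ
  | 0 => !![0, 2; 0, -20]
  | 1 => !![34, 1; 0, -10]
  | 2 => !![17, 19; 0, 6]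
  | 3 => !![-3, -10; 4, 2]
  | _ => !![-7, 0; -2, 0]

/-- The values at the endpoints of `pentagon`. -/
def pentagonC : ℕ → ℝ
  | 0 => 0
  | 1 => 9
  | 2 => -4
  | 3 => 11
  | _ => -1

/-- The determinant coefficients at the endpoints of `pentagon`. -/
def pentagonD : ℕ → ℝ
  | 0 => 9
  | 1 => -11
  | 2 => -8
  | 3 => 5
  | _ => -9

lemma corner_pentagonX (k : ℕ) (hk : k ≤ 4) :
    corner (fun _ => 2) pentagonA pentagonB k = pentagonX k := by
  ext i α
  rw [corner_apply]
  interval_cases k <;> fin_cases i <;> fin_cases α <;>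
    norm_num [pentagonA, pentagonB, pentagonX, Finset.sum_range_succ]

lemma corner_pentagonY (k : ℕ) (hk : k ≤ 4) :
    corner (fun _ => 2) pentagonW (fun j => perp (pentagonB j)) k = pentagonY k := by
  ext i α
  rw [corner_apply]
  interval_cases k <;> fin_cases i <;> fin_cases α <;>
    norm_num [pentagonW, pentagonB, pentagonY, perp, Finset.sum_range_succ]

/-- An explicit planar configuration with five endpoints. -/
def pentagon : PlanarConfig 4 where
  a := pentagonA
  w := pentagonW
  b := pentagonB
  κ _ := 2
  c := pentagonC
  d := pentagonD
  b_zero := rfl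
  b_one := rfl
  one_lt _ _ := by norm_num
  sum_a := by
    ext i α
    fin_cases i <;> fin_cases α <;>
      norm_num [Finset.sum_range_succ, vecMulVec_apply, pentagonA, pentagonB]
  sum_w := by
    ext i α
    fin_cases i <;> fin_cases α <;>
      norm_num [Finset.sum_range_succ, vecMulVec_apply, pentagonW, pentagonB]
  cross_a j hj := by interval_cases j <;> norm_num [cross, pentagonA]
  cross_a_last := by norm_num [cross, pentagonA]
  cross_b j hj := by interval_cases j <;> norm_num [cross, pentagonB]
  cross_b_last := by norm_num [cross, pentagonB]
  gap_pos k hk l hl hkl := by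
    rw [corner_pentagonX k hk, corner_pentagonX l hl, corner_pentagonY k hk, gap_eq]
    interval_cases k <;> interval_cases l <;> first
      | exact absurd rfl hkl
      | norm_num [pentagonX, pentagonY, pentagonC, pentagonD]

/-! ### Adding an endpoint by breaking and bending the last edge. -/

namespace PlanarConfig

/-- The correction of the first two left factors that compensates the bending of the last edge. -/
def correction (v β u b' : Fin 2 → ℝ) (ε : ℝ) (j : ℕ) : Fin 2 → ℝ :=
  match j with
  | 0 => (ε / 2) • (b' 0 • u + β 0 • v)
  | 1 => (ε / 2) • (b' 1 • u + β 1 • v)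
  | _ => 0

/-- The left factors after the edge `m` has been broken into two. -/
def splitLeft (v b : ℕ → Fin 2 → ℝ) (m : ℕ) (u β : Fin 2 → ℝ) (ε : ℝ) (j : ℕ) : Fin 2 → ℝ :=
  if j < m then v j - correction (v m) β u (b m + ε • β) ε j
  else if j = m then (1 / 2 : ℝ) • v m else (1 / 2 : ℝ) • (v m + ε • u)

/-- The right factors after the edge `m` has been broken into two. -/
def splitRight (b : ℕ → Fin 2 → ℝ) (m : ℕ) (β : Fin 2 → ℝ) (ε : ℝ) (j : ℕ) : Fin 2 → ℝ :=
  if j ≤ m then b j else b m + ε • β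

/-- The factors `κ` after the edge `m` has been broken into two. -/
def splitFactor (κ : ℕ → ℝ) (m : ℕ) (j : ℕ) : ℝ :=
  if j < m then κ j else if j = m then 2 * κ m else 2 * κ m - 1

variable {v b : ℕ → Fin 2 → ℝ} {m : ℕ} {u β : Fin 2 → ℝ} {ε : ℝ} {κ : ℕ → ℝ}

lemma correction_zero (v β u b' : Fin 2 → ℝ) (j : ℕ) : correction v β u b' 0 j = 0 := by
  rcases j with _ | _ | j <;> simp [correction]

lemma splitLeft_zero (j : ℕ) :
    splitLeft v b m u β 0 j = if j < m then v j else (1 / 2 : ℝ) • v m := by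
  simp [splitLeft, correction_zero]

lemma splitRight_zero (j : ℕ) : splitRight b m β 0 j = b (min j m) := by
  by_cases h : j ≤ m
  · simp [splitRight, h]
  · simp [splitRight, h, min_eq_right (not_le.mp h).le]

lemma continuous_splitLeft (j : ℕ) : Continuous fun ε => splitLeft v b m u β ε j := by
  unfold splitLeft
  split_ifs
  · rcases j with _ | _ | j <;> simp only [correction] <;> fun_prop
  · fun_prop
  · fun_prop

lemma continuous_splitRight (j : ℕ) : Continuous fun ε => splitRight b m β ε j := by
  unfold splitRight
  split_ifs <;> fun_prop

lemma one_lt_splitFactor (h : ∀ j ≤ m, 1 < κ j) (j : ℕ) : 1 < splitFactor κ m j := by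
  have := h m le_rfl
  unfold splitFactor
  split_ifs with h1 h2
  · exact h j h1.le
  · linarith
  · linarith

/-- Since `b 0` and `b 1` are the standard basis, left factors on these two edges can produce any
matrix column by column, in particular the closing error `(ε / 2) (u ⊗ (b m + ε β) + v m ⊗ β)`. The
bound `2 ≤ m` keeps both edges away from the broken one. -/
lemma sum_split (hm : 2 ≤ m) (h0 : b 0 = ![1, 0]) (h1 : b 1 = ![0, 1])
    (hs : ∑ j ∈ Finset.range (m + 1), vecMulVec (v j) (b j) = 0) :
    ∑ j ∈ Finset.range (m + 1 + 1),
      vecMulVec (splitLeft v b m u β ε j) (splitRight b m β ε j) = 0 := by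
  have key : ∑ j ∈ Finset.range m, vecMulVec (splitLeft v b m u β ε j) (splitRight b m β ε j) =
      ∑ j ∈ Finset.range m, vecMulVec (v j) (b j) -
      ∑ j ∈ Finset.range m, vecMulVec (correction (v m) β u (b m + ε • β) ε j) (b j) := by
    rw [← Finset.sum_sub_distrib]
    refine Finset.sum_congr rfl fun j hj => ?_
    have hj := Finset.mem_range.mp hj
    simp [splitLeft, splitRight, hj, hj.le, sub_vecMulVec]
  obtain ⟨p, rfl⟩ := Nat.exists_eq_add_of_le' hm
  rw [Finset.sum_range_succ] at hs
  rw [Finset.sum_range_succ, Finset.sum_range_succ, key, eq_neg_of_add_eq_zero_left hs,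
    Finset.sum_range_succ', Finset.sum_range_succ']
  ext i α
  fin_cases α <;>
    simp [correction, splitLeft, splitRight, h0, h1, vecMulVec_apply] <;> ring

lemma perp_splitRight (j : ℕ) :
    perp (splitRight b m β ε j) = splitRight (fun j => perp (b j)) m (perp β) ε j := by
  unfold splitRight
  split_ifs
  · rfl
  · ext i; fin_cases i <;> simp [perp]; ring

lemma corner_congr {ι ι' : Type*} {κ κ' : ℕ → ℝ} {v v' : ℕ → ι → ℝ} {b b' : ℕ → ι' → ℝ} {k : ℕ}
    (hκ : κ k = κ' k)
    (hv : ∀ j ≤ k, v j = v' j) (hb : ∀ j ≤ k, b j = b' j) :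
    corner κ v b k = corner κ' v' b' k := by
  unfold corner
  rw [hκ, hv k le_rfl, hb k le_rfl]
  congr 1
  refine Finset.sum_congr rfl fun j hj => ?_
  rw [hv j (Finset.mem_range.mp hj).le, hb j (Finset.mem_range.mp hj).le]

/-- Halving the edge without bending leaves the endpoint in place: `2 κ · 1/2 = κ` for the first
half and `1/2 + (2 κ - 1) · 1/2 = κ` for the second. The correction has its own data `b₀`, `β₀`
because the lower polygon has rotated right factors but corrections computed from the unrotated
ones. -/
lemma corner_split_zero (v b : ℕ → Fin 2 → ℝ) (m : ℕ) (u β : Fin 2 → ℝ) (b₀ : ℕ → Fin 2 → ℝ)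
    (β₀ : Fin 2 → ℝ) (κ : ℕ → ℝ) {k : ℕ} (hk : k ≤ m + 1) :
    corner (splitFactor κ m) (splitLeft v b₀ m u β₀ 0) (splitRight b m β 0) k =
      corner κ v b (min k m) := by
  have hL (j : ℕ) (hj : j < m) : splitLeft v b₀ m u β₀ 0 j = v j := by
    rw [splitLeft_zero, if_pos hj]
  have hR (j : ℕ) (hj : j ≤ m) : splitRight b m β 0 j = b j := by
    rw [splitRight_zero, min_eq_left hj]
  have hsum : ∑ j ∈ Finset.range m, vecMulVec (splitLeft v b₀ m u β₀ 0 j) (splitRight b m β 0 j) =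
      ∑ j ∈ Finset.range m, vecMulVec (v j) (b j) := by
    refine Finset.sum_congr rfl fun j hj => ?_
    have hj := Finset.mem_range.mp hj
    rw [hL j hj, hR j hj.le]
  rcases lt_trichotomy k m with h | rfl | h
  · rw [min_eq_left h.le]
    exact corner_congr (if_pos h) (fun j hj => hL j (hj.trans_lt h))
      fun j hj => hR j (hj.trans h.le)
  · rw [min_self, corner, corner, hsum, hR k le_rfl, splitLeft_zero]
    ext i α
    simp [splitFactor, vecMulVec_apply]
    ring
  · obtain rfl : k = m + 1 := by omega
    rw [min_eq_right h.le, corner, corner, Finset.sum_range_succ, hsum, hR m le_rfl,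
      splitLeft_zero, splitLeft_zero, splitRight_zero]
    ext i α
    simp [splitFactor, vecMulVec_apply]
    ring

lemma corner_split_sub (v b : ℕ → Fin 2 → ℝ) (m : ℕ) (u β : Fin 2 → ℝ) (b₀ : ℕ → Fin 2 → ℝ)
    (β₀ : Fin 2 → ℝ) (κ : ℕ → ℝ) (ε : ℝ) :
    corner (splitFactor κ m) (splitLeft v b₀ m u β₀ ε) (splitRight b m β ε) (m + 1) -
      corner (splitFactor κ m) (splitLeft v b₀ m u β₀ ε) (splitRight b m β ε) m =
      (κ m - 1 / 2) • (vecMulVec (v m + ε • u) (b m + ε • β) - vecMulVec (v m) (b m)) := by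
  ext i α
  simp [corner_apply, Finset.sum_range_succ, splitFactor, splitLeft, splitRight, vecMulVec_apply]
  ring

lemma continuous_vecMulVec {f g : ℝ → Fin 2 → ℝ} (hf : Continuous f) (hg : Continuous g) :
    Continuous fun ε => vecMulVec (f ε) (g ε) := by
  refine continuous_matrix fun i α => ?_
  simp only [vecMulVec_apply]
  fun_prop

lemma continuous_corner (κ : ℕ → ℝ) {f g : ℝ → ℕ → Fin 2 → ℝ} (hf : ∀ j, Continuous fun ε => f ε j)
    (hg : ∀ j, Continuous fun ε => g ε j) (k : ℕ) :
    Continuous fun ε => corner κ (f ε) (g ε) k := by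
  unfold corner
  have (j : ℕ) := continuous_vecMulVec (hf j) (hg j)
  fun_prop

lemma continuous_pairing {f g : ℝ → Matrix (Fin 2) (Fin 2) ℝ} (hf : Continuous f)
    (hg : Continuous g) : Continuous fun ε => pairing (f ε) (g ε) := by
  unfold pairing
  fun_prop

lemma continuous_gap (d : ℝ) {c c' : ℝ → ℝ} {X Y X' : ℝ → Matrix (Fin 2) (Fin 2) ℝ}
    (hc : Continuous c) (hc' : Continuous c') (hX : Continuous X) (hY : Continuous Y)
    (hX' : Continuous X') : Continuous fun ε => gap (c ε) d (X ε) (Y ε) (c' ε) (X' ε) := by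
  unfold gap
  have := continuous_pairing hY (hX'.sub hX)
  have := (hX'.sub hX).matrix_det
  fun_prop

lemma continuous_cross {f g : ℝ → Fin 2 → ℝ} (hf : Continuous f) (hg : Continuous g) :
    Continuous fun ε => cross (f ε) (g ε) := by
  unfold cross
  fun_prop

lemma sq_add_sq_pos_of_cross_ne_zero {u v : Fin 2 → ℝ} (h : cross u v ≠ 0) :
    0 < u 0 ^ 2 + u 1 ^ 2 := by
  by_contra! hle
  have h0 : u 0 = 0 := by nlinarith [sq_nonneg (u 0), sq_nonneg (u 1)]
  have h1 : u 1 = 0 := by nlinarith [sq_nonneg (u 0), sq_nonneg (u 1)]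
  exact h (by simp [cross, h0, h1])

/-- The increment of the value follows the trapezoidal rule, which makes the gaps in the two
directions equal; a single inequality then settles both. -/
lemma gap_midpoint (c d : ℝ) (X Y X' Y' : Matrix (Fin 2) (Fin 2) ℝ) :
    gap c d X Y (c + 1 / 2 * pairing (Y + Y') (X' - X)) X' =
      1 / 2 * pairing (Y' - Y) (X' - X) - d * (X' - X).det := by
  simp [gap_eq, pairing, Fin.sum_univ_two, det_fin_two]
  ring

lemma gap_midpoint' (c d : ℝ) (X Y X' Y' : Matrix (Fin 2) (Fin 2) ℝ) :
    gap (c + 1 / 2 * pairing (Y + Y') (X' - X)) d X' Y' c X =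
      1 / 2 * pairing (Y' - Y) (X' - X) - d * (X' - X).det := by
  simp [gap_eq, pairing, Fin.sum_univ_two, det_fin_two]
  ring

/-- Bending an edge separates its two halves monotonically. -/
lemma bending_identity (a w b : Fin 2 → ℝ) (d t ε q : ℝ) :
    1 / 2 * pairing (t • (vecMulVec (w + ε • q • a) (perp b + ε • perp (perp b)) -
          vecMulVec w (perp b)))
        (t • (vecMulVec (a + ε • perp a) (b + ε • perp b) - vecMulVec a b)) -
      d * (t • (vecMulVec (a + ε • perp a) (b + ε • perp b) - vecMulVec a b)).det =
    (t * ε) ^ 2 * (b 0 ^ 2 + b 1 ^ 2) *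
      (1 / 2 * (q * (a 0 ^ 2 + a 1 ^ 2) - (a 0 * w 1 - a 1 * w 0)) + d * (a 0 ^ 2 + a 1 ^ 2)) := by
  simp only [pairing, Fin.sum_univ_two, det_fin_two, Matrix.smul_apply, Matrix.sub_apply,
    vecMulVec_apply, Pi.add_apply, Pi.smul_apply, smul_eq_mul, perp_zero, perp_one]
  ring

lemma exists_succ (T : PlanarConfig m) (hm : 2 ≤ m) : Nonempty (PlanarConfig (m + 1)) := by
  have ha : 0 < T.a m 0 ^ 2 + T.a m 1 ^ 2 := sq_add_sq_pos_of_cross_ne_zero T.cross_a_last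
  have hb : 0 < T.b m 0 ^ 2 + T.b m 1 ^ 2 := sq_add_sq_pos_of_cross_ne_zero T.cross_b_last
  -- The last factor in `bending_identity` is affine in `q` with slope `|a|² / 2 > 0`, so it can be
  -- made positive whatever `w` and `d` are; this choice gives it the value `1 / 2`.
  obtain ⟨q, hq⟩ : ∃ q : ℝ, 0 < 1 / 2 * (q * (T.a m 0 ^ 2 + T.a m 1 ^ 2) -
      (T.a m 0 * T.w m 1 - T.a m 1 * T.w m 0)) + T.d m * (T.a m 0 ^ 2 + T.a m 1 ^ 2) := by
    refine ⟨((T.a m 0 * T.w m 1 - T.a m 1 * T.w m 0) + 1) / (T.a m 0 ^ 2 + T.a m 1 ^ 2) -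
      2 * T.d m, ?_⟩
    rw [sub_mul, div_mul_cancel₀ _ ha.ne']
    linarith
  let K := splitFactor T.κ m
  let A (ε : ℝ) := splitLeft T.a T.b m (perp (T.a m)) (perp (T.b m)) ε
  let W (ε : ℝ) := splitLeft T.w T.b m (q • T.a m) (perp (T.b m)) ε
  let B (ε : ℝ) := splitRight T.b m (perp (T.b m)) ε
  let X (ε : ℝ) (k : ℕ) := corner K (A ε) (B ε) k
  let Y (ε : ℝ) (k : ℕ) := corner K (W ε) (fun j => perp (B ε j)) k
  let c (ε : ℝ) (k : ℕ) := if k ≤ m then T.c k else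
    T.c m + 1 / 2 * pairing (Y ε m + Y ε (m + 1)) (X ε (m + 1) - X ε m)
  let d (k : ℕ) := T.d (min k m)
  have cA (j : ℕ) : Continuous fun ε => A ε j := continuous_splitLeft j
  have cW (j : ℕ) : Continuous fun ε => W ε j := continuous_splitLeft j
  have cB (j : ℕ) : Continuous fun ε => B ε j := continuous_splitRight j
  have cX (k : ℕ) : Continuous fun ε => X ε k := continuous_corner K cA cB k
  have hperp (ε : ℝ) : (fun j => perp (B ε j)) =
      splitRight (fun j => perp (T.b j)) m (perp (perp (T.b m))) ε :=
    funext fun j => perp_splitRight j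
  have cY (k : ℕ) : Continuous fun ε => Y ε k := by
    refine continuous_corner K cW (fun j => ?_) k
    simp only [B, perp_splitRight]
    exact continuous_splitRight j
  have cc (k : ℕ) : Continuous fun ε => c ε k := by
    simp only [c]
    split_ifs
    · exact continuous_const
    · exact continuous_const.add (continuous_const.mul
        (continuous_pairing ((cY m).add (cY (m + 1))) ((cX (m + 1)).sub (cX m))))
  have X0 (k : ℕ) (hk : k ≤ m + 1) : X 0 k = corner T.κ T.a T.b (min k m) :=
    corner_split_zero T.a T.b m _ _ _ _ T.κ hk
  have Y0 (k : ℕ) (hk : k ≤ m + 1) : Y 0 k = corner T.κ T.w (fun j => perp (T.b j)) (min k m) := by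
    simp only [Y, hperp]
    exact corner_split_zero T.w (fun j => perp (T.b j)) m _ _ _ _ T.κ hk
  have c0 (k : ℕ) (hk : k ≤ m + 1) : c 0 k = T.c (min k m) := by
    by_cases h : k ≤ m
    · simp [c, h]
    · have : X 0 (m + 1) = X 0 m := by rw [X0 _ le_rfl, X0 _ m.le_succ]; simp
      simp [c, h, min_eq_right (not_le.mp h).le, this, pairing]
  have A0 (j : ℕ) : A 0 j = if j < m then T.a j else (1 / 2 : ℝ) • T.a m := splitLeft_zero j
  have B0 (j : ℕ) : B 0 j = T.b (min j m) := splitRight_zero j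
  -- Only pairs descending from different old endpoints are treated by continuity; for the two
  -- halves of the broken edge the gap degenerates at `ε = 0`.
  have ev_gap : ∀ᶠ ε in 𝓝[>] (0 : ℝ), ∀ k ∈ Finset.range (m + 2), ∀ l ∈ Finset.range (m + 2),
      min k m ≠ min l m → 0 < gap (c ε k) (d k) (X ε k) (Y ε k) (c ε l) (X ε l) := by
    simp only [Filter.eventually_all_finset]
    intro k hk l hl
    by_cases hkl : min k m = min l m
    · exact Eventually.of_forall fun _ h => absurd hkl h
    have hk : k ≤ m + 1 := by simpa using Nat.lt_succ_iff.mp (Finset.mem_range.mp hk)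
    have hl : l ≤ m + 1 := by simpa using Nat.lt_succ_iff.mp (Finset.mem_range.mp hl)
    have hcont := continuous_gap (d k) (cc k) (cc l) (cX k) (cY k) (cX l)
    have hpos : 0 < gap (c 0 k) (d k) (X 0 k) (Y 0 k) (c 0 l) (X 0 l) := by
      rw [c0 k hk, c0 l hl, X0 k hk, X0 l hl, Y0 k hk]
      exact T.gap_pos _ (min_le_right _ _) _ (min_le_right _ _) hkl
    filter_upwards [nhdsWithin_le_nhds (hcont.continuousAt.eventually (lt_mem_nhds hpos))]
      with ε hε _ using hε
  have ev_cross {f g : ℝ → Fin 2 → ℝ} (hf : Continuous f) (hg : Continuous g)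
      (h : cross (f 0) (g 0) ≠ 0) : ∀ᶠ ε in 𝓝[>] (0 : ℝ), cross (f ε) (g ε) ≠ 0 :=
    nhdsWithin_le_nhds ((continuous_cross hf hg).continuousAt.eventually_ne h)
  have hhalf (u v : Fin 2 → ℝ) (h : cross u v ≠ 0) : cross u ((1 / 2 : ℝ) • v) ≠ 0 := by
    have : cross u ((1 / 2 : ℝ) • v) = 1 / 2 * cross u v := by simp [cross]; ring
    rw [this]
    exact mul_ne_zero (by norm_num) h
  have hhalf' (u v : Fin 2 → ℝ) (h : cross u v ≠ 0) : cross ((1 / 2 : ℝ) • u) v ≠ 0 := by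
    have : cross ((1 / 2 : ℝ) • u) v = 1 / 2 * cross u v := by simp [cross]; ring
    rw [this]
    exact mul_ne_zero (by norm_num) h
  have ev_a : ∀ᶠ ε in 𝓝[>] (0 : ℝ), ∀ j ∈ Finset.range m, cross (A ε j) (A ε (j + 1)) ≠ 0 := by
    rw [Filter.eventually_all_finset]
    intro j hj
    have hj := Finset.mem_range.mp hj
    refine ev_cross (cA j) (cA (j + 1)) ?_
    rw [A0, A0, if_pos hj]
    split_ifs with h
    · exact T.cross_a j hj
    · obtain rfl : m = j + 1 := by omega
      exact hhalf _ _ (T.cross_a j hj)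
  have ev_b : ∀ᶠ ε in 𝓝[>] (0 : ℝ), ∀ j ∈ Finset.range m, cross (B ε j) (B ε (j + 1)) ≠ 0 := by
    rw [Filter.eventually_all_finset]
    intro j hj
    have hj := Finset.mem_range.mp hj
    refine ev_cross (cB j) (cB (j + 1)) ?_
    rw [B0, B0, min_eq_left hj.le, min_eq_left hj]
    exact T.cross_b j hj
  have ev_a' : ∀ᶠ ε in 𝓝[>] (0 : ℝ), cross (A ε (m + 1)) (A ε 0) ≠ 0 := by
    refine ev_cross (cA (m + 1)) (cA 0) ?_
    rw [A0, A0, if_neg (by omega), if_pos (by omega)]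
    exact hhalf' _ _ T.cross_a_last
  have ev_b' : ∀ᶠ ε in 𝓝[>] (0 : ℝ), cross (B ε (m + 1)) (B ε 0) ≠ 0 := by
    refine ev_cross (cB (m + 1)) (cB 0) ?_
    rw [B0, B0, min_eq_right m.le_succ, min_eq_left m.zero_le]
    exact T.cross_b_last
  obtain ⟨ε, hgap, hca, hcb, hca', hcb', hε⟩ := (ev_gap.and (ev_a.and (ev_b.and (ev_a'.and
    (ev_b'.and self_mem_nhdsWithin))))).exists
  have hε : 0 < ε := hε
  have hκ : 0 < T.κ m - 1 / 2 := by linarith [T.one_lt m le_rfl]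
  have hbend : 0 < 1 / 2 * pairing (Y ε (m + 1) - Y ε m) (X ε (m + 1) - X ε m) -
      T.d m * (X ε (m + 1) - X ε m).det := by
    simp only [X, Y, hperp]
    simp only [K, A, W, B]
    rw [corner_split_sub, corner_split_sub, bending_identity]
    exact mul_pos (mul_pos (pow_pos (mul_pos hκ hε) 2) hb) hq
  have cm : c ε m = T.c m := if_pos le_rfl
  have cm' : c ε (m + 1) = T.c m + 1 / 2 * pairing (Y ε m + Y ε (m + 1)) (X ε (m + 1) - X ε m) :=
    if_neg (by omega)
  refine ⟨{
    a := A ε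
    w := W ε
    b := B ε
    κ := K
    c := c ε
    d := d
    b_zero := ?_
    b_one := ?_
    one_lt := fun j _ => one_lt_splitFactor T.one_lt j
    sum_a := sum_split hm T.b_zero T.b_one T.sum_a
    sum_w := sum_split hm T.b_zero T.b_one T.sum_w
    cross_a := ?_
    cross_a_last := hca'
    cross_b := ?_
    cross_b_last := hcb'
    gap_pos := ?_ }⟩
  · simp only [B, splitRight]
    rw [if_pos (by omega), T.b_zero]
  · simp only [B, splitRight]
    rw [if_pos (by omega), T.b_one]
  · intro j hj
    rcases (Nat.lt_succ_iff.mp hj).lt_or_eq with h | rfl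
    · exact hca j (Finset.mem_range.mpr h)
    -- The two halves are parallel at `ε = 0`, so independence comes from the bending by `perp` and
    -- not from continuity.
    · have : cross (A ε j) (A ε (j + 1)) = ε / 4 * (T.a j 0 ^ 2 + T.a j 1 ^ 2) := by
        simp [A, splitLeft, cross, perp_zero, perp_one]; ring
      rw [this]
      positivity
  · intro j hj
    rcases (Nat.lt_succ_iff.mp hj).lt_or_eq with h | rfl
    · exact hcb j (Finset.mem_range.mpr h)
    · have : cross (B ε j) (B ε (j + 1)) = ε * (T.b j 0 ^ 2 + T.b j 1 ^ 2) := by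
        simp [B, splitRight, cross, perp_zero, perp_one]; ring
      rw [this]
      positivity
  · intro k hk l hl hkl
    by_cases hmin : min k m = min l m
    · have : (k = m ∧ l = m + 1) ∨ (k = m + 1 ∧ l = m) := by omega
      rcases this with ⟨rfl, rfl⟩ | ⟨rfl, rfl⟩
      · change 0 < gap (c ε k) (T.d (min k k)) (X ε k) (Y ε k) (c ε (k + 1)) (X ε (k + 1))
        rw [cm, cm', gap_midpoint, min_self]
        exact hbend
      · change 0 < gap (c ε (l + 1)) (T.d (min (l + 1) l)) (X ε (l + 1)) (Y ε (l + 1)) (c ε l) (X ε l)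
        rw [cm, cm', gap_midpoint', min_eq_right l.le_succ]
        exact hbend
    · exact hgap k (Finset.mem_range.mpr (by omega)) l (Finset.mem_range.mpr (by omega)) hmin

theorem nonempty {m : ℕ} (hm : 4 ≤ m) : Nonempty (PlanarConfig m) := by
  induction m, hm using Nat.le_induction with
  | base => exact ⟨pentagon⟩
  | succ m hm ih => exact ih.elim fun T => T.exists_succ (by omega)

end PlanarConfig

section

/-! ### Smooth regularisation of the maximum -/

/-- The primitive of the smooth transition function which vanishes on the negative half-line. -/
def smoothRamp (x : ℝ) : ℝ := ∫ t in (0 : ℝ)..x, Real.smoothTransition t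

lemma hasDerivAt_smoothRamp (x : ℝ) : HasDerivAt smoothRamp (Real.smoothTransition x) x :=
  intervalIntegral.integral_hasDerivAt_right (Real.smoothTransition.continuous.intervalIntegrable _ _)
    (Real.smoothTransition.continuous.stronglyMeasurableAtFilter _ _)
    Real.smoothTransition.continuous.continuousAt

lemma deriv_smoothRamp : deriv smoothRamp = Real.smoothTransition :=
  funext fun x => (hasDerivAt_smoothRamp x).deriv

lemma contDiff_smoothRamp : ContDiff ℝ ∞ smoothRamp := by
  rw [contDiff_infty_iff_deriv, deriv_smoothRamp]
  exact ⟨fun x => (hasDerivAt_smoothRamp x).differentiableAt, Real.smoothTransition.contDiff⟩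

lemma monotone_smoothRamp : Monotone smoothRamp :=
  monotone_of_deriv_nonneg (fun x => (hasDerivAt_smoothRamp x).differentiableAt) fun x => by
    rw [deriv_smoothRamp]; exact Real.smoothTransition.nonneg x

lemma monotone_sub_smoothRamp : Monotone fun x => x - smoothRamp x :=
  monotone_of_deriv_nonneg
    (fun x => differentiableAt_id.sub (hasDerivAt_smoothRamp x).differentiableAt) fun x => by
    have := (hasDerivAt_id x).sub (hasDerivAt_smoothRamp x)
    rw [show deriv (fun x => x - smoothRamp x) x = _ from this.deriv]
    linarith [Real.smoothTransition.le_one x]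

lemma convexOn_smoothRamp : ConvexOn ℝ Set.univ smoothRamp := by
  refine Monotone.convexOn_univ_of_deriv
    (fun x => (hasDerivAt_smoothRamp x).differentiableAt) ?_
  rw [deriv_smoothRamp]
  exact Real.smoothTransition.monotone

lemma smoothRamp_of_nonpos {x : ℝ} (hx : x ≤ 0) : smoothRamp x = 0 := by
  unfold smoothRamp
  rw [intervalIntegral.integral_congr (g := fun _ => 0)]
  · simp
  · intro t ht
    rw [Set.uIcc_of_ge hx] at ht
    exact Real.smoothTransition.zero_of_nonpos ht.2

lemma smoothRamp_of_one_le {x : ℝ} (hx : 1 ≤ x) : smoothRamp x = x - (1 - smoothRamp 1) := by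
  have hi (a b : ℝ) := Real.smoothTransition.continuous.intervalIntegrable (μ := MeasureTheory.volume) a b
  have h : smoothRamp 1 + ∫ t in (1 : ℝ)..x, Real.smoothTransition t = smoothRamp x :=
    intervalIntegral.integral_add_adjacent_intervals (hi _ _) (hi _ _)
  rw [intervalIntegral.integral_congr (g := fun _ => 1)] at h
  · simp at h
    linarith
  · intro t ht
    rw [Set.uIcc_of_le hx] at ht
    exact Real.smoothTransition.one_of_one_le ht.1

/-- A smooth convex regularisation of the positive part. -/
lemma exists_smooth_posPart {δ : ℝ} (hδ : 0 < δ) : ∃ ρ : ℝ → ℝ, ContDiff ℝ ∞ ρ ∧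
    ConvexOn ℝ Set.univ ρ ∧ Monotone ρ ∧ (Monotone fun x => x - ρ x) ∧
    (∀ x ≤ -δ, ρ x = 0) ∧ (∀ x, δ ≤ x → ρ x = x) := by
  set C := 1 - smoothRamp 1 with hC
  have hC1 : C ≤ 1 := by
    have := monotone_smoothRamp (zero_le_one (α := ℝ))
    rw [smoothRamp_of_nonpos le_rfl] at this
    linarith
  have hC0 : 0 ≤ C := by
    have := monotone_sub_smoothRamp (zero_le_one (α := ℝ))
    simp only [smoothRamp_of_nonpos le_rfl] at this
    linarith
  have hdiv (x : ℝ) : δ * (x / δ) = x := by field_simp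
  -- The shift `C` cancels the constant by which the ramp lags behind the identity, and `0 ≤ C ≤ 1`
  -- confines the transition to `[-δ, δ]`.
  refine ⟨fun x => δ * smoothRamp (x / δ + C), ?_, ?_, ?_, ?_, ?_, ?_⟩
  · exact contDiff_const.mul (contDiff_smoothRamp.comp ((contDiff_id.div_const δ).add contDiff_const))
  · refine ⟨convex_univ, fun x _ y _ a b ha hb hab => ?_⟩
    have := convexOn_smoothRamp.2 (Set.mem_univ (x / δ + C)) (Set.mem_univ (y / δ + C)) ha hb hab
    simp only [smul_eq_mul] at this ⊢
    have e : (a * x + b * y) / δ + C = a * (x / δ + C) + b * (y / δ + C) := by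
      have : C = (a + b) * C := by rw [hab, one_mul]
      linear_combination this
    rw [e]
    nlinarith
  · intro x y hxy
    exact mul_le_mul_of_nonneg_left (monotone_smoothRamp (by gcongr)) hδ.le
  · intro x y hxy
    have : x / δ + C ≤ y / δ + C := by gcongr
    have := mul_le_mul_of_nonneg_left (monotone_sub_smoothRamp this) hδ.le
    simp only [mul_sub, mul_add, hdiv] at this
    simp only
    linarith
  · intro x hx
    have : x / δ ≤ -1 := by rw [div_le_iff₀ hδ]; linarith
    simp [smoothRamp_of_nonpos (show x / δ + C ≤ 0 by linarith)]
  · intro x hx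
    have : 1 ≤ x / δ := by rw [le_div_iff₀ hδ]; linarith
    simp only [smoothRamp_of_one_le (show 1 ≤ x / δ + C by linarith), ← hC]
    rw [add_sub_cancel_right, hdiv]

variable {M n : ℕ}

/-- The function `(s, t) ↦ t + ρ (s - t)` is convex, and it is nondecreasing in `s` by `hm` and in
`t` by `hm'`; hence it preserves convexity of the functions of the minors. -/
lemma Polyconvex.smoothMax {f g : Matrix (Fin M) (Fin n) ℝ → ℝ} (hf : Polyconvex f)
    (hg : Polyconvex g) {ρ : ℝ → ℝ} (hρ : ConvexOn ℝ Set.univ ρ) (hm : Monotone ρ)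
    (hm' : Monotone fun x => x - ρ x) : Polyconvex fun X => g X + ρ (f X - g X) := by
  obtain ⟨F, hF, hfF⟩ := hf
  obtain ⟨G, hG, hgG⟩ := hg
  refine ⟨fun A => G A + ρ (F A - G A), ⟨convex_univ, fun x _ y _ a b ha hb hab => ?_⟩,
    fun X => by simp only [hfF, hgG]⟩
  have h1 := hF.2 (Set.mem_univ x) (Set.mem_univ y) ha hb hab
  have h2 := hG.2 (Set.mem_univ x) (Set.mem_univ y) ha hb hab
  have h3 := hρ.2 (Set.mem_univ (F x - G x)) (Set.mem_univ (F y - G y)) ha hb hab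
  simp only [smul_eq_mul] at h1 h2 h3 ⊢
  set p := a • x + b • y
  set P := a * F x + b * F y
  set Q := a * G x + b * G y
  have h4 : ρ (F p - G p) ≤ ρ (P - G p) := hm (by linarith)
  have h5 := hm' (show P - Q ≤ P - G p by linarith)
  have h6 : a * (F x - G x) + b * (F y - G y) = P - Q := by simp only [P, Q]; ring
  rw [h6] at h3
  simp only at h5
  have h7 : a * (G x + ρ (F x - G x)) + b * (G y + ρ (F y - G y)) =
    Q + (a * ρ (F x - G x) + b * ρ (F y - G y)) := by simp only [Q]; ring
  rw [h7]
  linarith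

lemma eventually_nhdsGT_zero_lt {a : ℝ} (ha : 0 < a) : ∀ᶠ η in 𝓝[>] (0 : ℝ), η < a :=
  nhdsWithin_le_nhds (gt_mem_nhds ha)

/-- Smooth polyconvex functions can be glued where each of them is strictly the largest. -/
lemma exists_smooth_polyconvex_glue {ι : Type*} (s : Finset ι) (hs : s.Nonempty)
    (f : ι → Matrix (Fin M) (Fin n) ℝ → ℝ) (A : ι → Matrix (Fin M) (Fin n) ℝ)
    (hf : ∀ k, ContDiff ℝ ∞ (f k)) (hp : ∀ k, Polyconvex (f k)) :
    (∀ k ∈ s, ∀ l ∈ s, k ≠ l → f k (A l) < f l (A l)) → ∀ ε : ℝ, 0 < ε →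
    ∃ g : Matrix (Fin M) (Fin n) ℝ → ℝ, ContDiff ℝ ∞ g ∧ Polyconvex g ∧
      (∀ X, ∃ k ∈ s, g X ≤ f k X + ε) ∧ ∀ l ∈ s, g =ᶠ[𝓝 (A l)] f l := by
  -- The bound by some `f k + ε` with arbitrary `ε` is carried along so that the function glued so
  -- far still lies strictly below the next `f a` at `A a`.
  induction hs using Finset.Nonempty.cons_induction with
  | singleton a =>
    intro _ ε hε
    refine ⟨f a, hf a, hp a, fun X => ⟨a, by simp, by linarith⟩, fun l hl => ?_⟩
    rw [Finset.mem_singleton.mp hl]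
  | cons a s ha hs ih =>
    intro hlt ε hε
    have ev : ∀ᶠ η in 𝓝[>] (0 : ℝ), ∀ k ∈ s, f k (A a) + η < f a (A a) := by
      rw [Filter.eventually_all_finset]
      intro k hk
      have hlt' := hlt k (Finset.mem_cons_of_mem hk) a (Finset.mem_cons_self a s)
        fun h => ha (h ▸ hk)
      have hc : Continuous fun η : ℝ => f k (A a) + η := by fun_prop
      refine nhdsWithin_le_nhds (hc.continuousAt.eventually (gt_mem_nhds ?_))
      simpa using hlt'
    obtain ⟨η, hη, hηε, hη0⟩ := (ev.and ((eventually_nhdsGT_zero_lt (half_pos hε)).and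
      self_mem_nhdsWithin)).exists
    have hη0 : 0 < η := hη0
    obtain ⟨g, hgs, hgp, hgb, hgl⟩ := ih (fun k hk l hl => hlt k (Finset.mem_cons_of_mem hk) l
      (Finset.mem_cons_of_mem hl)) η hη0
    have hga : g (A a) < f a (A a) := by
      obtain ⟨k, hk, hgk⟩ := hgb (A a)
      exact hgk.trans_lt (hη k hk)
    have hal (l : ι) (hl : l ∈ s) : f a (A l) < g (A l) := by
      rw [(hgl l hl).eq_of_nhds]
      exact hlt a (Finset.mem_cons_self a s) l (Finset.mem_cons_of_mem hl) fun h => ha (h ▸ hl)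
    have ev : ∀ᶠ δ in 𝓝[>] (0 : ℝ), ∀ l ∈ s, δ < g (A l) - f a (A l) := by
      rw [Filter.eventually_all_finset]
      intro l hl
      exact eventually_nhdsGT_zero_lt (sub_pos.mpr (hal l hl))
    obtain ⟨δ, hδl, hδa, hδε, hδ0⟩ := (ev.and ((eventually_nhdsGT_zero_lt
      (sub_pos.mpr hga)).and ((eventually_nhdsGT_zero_lt (half_pos hε)).and
      self_mem_nhdsWithin))).exists
    have hδ0 : 0 < δ := hδ0
    -- As `δ` is below every separation `|f a - g|` at the nodes, near each node `ρ` equals either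
    -- `0` or the identity, and the glued function is exactly the larger one.
    obtain ⟨ρ, hρs, hρc, hρm, hρm', hρ0, hρ1⟩ := exists_smooth_posPart hδ0
    refine ⟨fun X => g X + ρ (f a X - g X), hgs.add (hρs.comp ((hf a).sub hgs)),
      (hp a).smoothMax hgp hρc hρm hρm', fun X => ?_, fun l hl => ?_⟩
    · rcases le_total (f a X - g X) δ with h | h
      · obtain ⟨k, hk, hgk⟩ := hgb X
        have := hρm h
        rw [hρ1 δ le_rfl] at this
        exact ⟨k, Finset.mem_cons_of_mem hk, by linarith⟩
      · refine ⟨a, Finset.mem_cons_self a s, ?_⟩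
        simp only [hρ1 _ h]
        linarith
    · rcases Finset.mem_cons.mp hl with rfl | hl
      · have hc : Continuous fun X => f l X - g X := (hf l).continuous.sub hgs.continuous
        filter_upwards [hc.continuousAt.eventually (lt_mem_nhds hδa)] with X hX
        simp only [hρ1 _ (le_of_lt hX)]
        ring
      · have hc : Continuous fun X => g X - f a X := hgs.continuous.sub (hf a).continuous
        filter_upwards [hc.continuousAt.eventually (lt_mem_nhds (hδl l hl)), hgl l hl] with X hX hX'
        simp only [← hX', hρ0 (f a X - g X) (by linarith), add_zero]

end

section

/-! ### Interpolation by strongly polyconvex functions -/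

/-- A smooth convex function of linear growth which agrees with `x ^ 2 / 2` to second order. -/
def softSq (δ x : ℝ) : ℝ := δ * √(δ ^ 2 + x ^ 2) - δ ^ 2

/-- The derivative of `softSq`. -/
def softSqDeriv (δ x : ℝ) : ℝ := δ * (x / √(δ ^ 2 + x ^ 2))

section softSq

variable {δ : ℝ}

lemma softSq_zero_left (x : ℝ) : softSq 0 x = 0 := by simp [softSq]

lemma softSq_zero_right (hδ : 0 < δ) : softSq δ 0 = 0 := by
  simp [softSq, Real.sqrt_sq hδ.le]
  ring

lemma softSqDeriv_zero : softSqDeriv δ 0 = 0 := by simp [softSqDeriv]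

lemma contDiff_softSq (hδ : 0 < δ) : ContDiff ℝ ∞ (softSq δ) :=
  (contDiff_const.mul ((contDiff_const.add (contDiff_id.pow 2)).sqrt
    fun x => (by positivity : (0 : ℝ) < δ ^ 2 + x ^ 2).ne')).sub contDiff_const

/-- The square root is the norm of the vector `(δ, x)`, which depends affinely on `x`. -/
lemma convexOn_softSq (hδ : 0 < δ) : ConvexOn ℝ Set.univ (softSq δ) := by
  have hn (x : ℝ) : √(δ ^ 2 + x ^ 2) = ‖(⟨δ, x⟩ : ℂ)‖ := by
    rw [Complex.norm_def, Complex.normSq_mk, sq, sq]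
  refine ⟨convex_univ, fun x _ y _ a b ha hb hab => ?_⟩
  have h : √(δ ^ 2 + (a * x + b * y) ^ 2) ≤ a * √(δ ^ 2 + x ^ 2) + b * √(δ ^ 2 + y ^ 2) := by
    have e : (⟨δ, a * x + b * y⟩ : ℂ) = a • (⟨δ, x⟩ : ℂ) + b • (⟨δ, y⟩ : ℂ) := by
      apply Complex.ext
      · simp [← add_mul, hab]
      · simp
    rw [hn, hn, hn, e]
    refine (norm_add_le _ _).trans ?_
    rw [norm_smul, norm_smul, Real.norm_of_nonneg ha, Real.norm_of_nonneg hb]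
  simp only [softSq, smul_eq_mul]
  have := mul_le_mul_of_nonneg_left h hδ.le
  have e : δ ^ 2 = (a + b) * δ ^ 2 := by rw [hab, one_mul]
  nlinarith

lemma hasDerivAt_softSq (hδ : 0 < δ) (x : ℝ) : HasDerivAt (softSq δ) (softSqDeriv δ x) x := by
  have hp : (0 : ℝ) < δ ^ 2 + x ^ 2 := by positivity
  have h := ((((hasDerivAt_pow 2 x).const_add (δ ^ 2)).sqrt hp.ne').const_mul δ).sub_const (δ ^ 2)
  refine h.congr_deriv ?_
  simp only [softSqDeriv]
  field_simp
  ring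

lemma hasDerivAt_softSqDeriv (hδ : 0 < δ) : HasDerivAt (softSqDeriv δ) 1 0 := by
  have hp : (0 : ℝ) < δ ^ 2 + 0 ^ 2 := by positivity
  have hs := ((hasDerivAt_pow 2 (0 : ℝ)).const_add (δ ^ 2)).sqrt hp.ne'
  have h := ((hasDerivAt_id (0 : ℝ)).div hs (Real.sqrt_pos.mpr hp).ne').const_mul δ
  refine h.congr_deriv ?_
  have : √(δ ^ 2) = δ := Real.sqrt_sq hδ.le
  simp [this]
  field_simp

end softSq

variable {M n : ℕ}

lemma Polyconvex.add {f g : Matrix (Fin M) (Fin n) ℝ → ℝ} (hf : Polyconvex f)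
    (hg : Polyconvex g) : Polyconvex fun X => f X + g X := by
  obtain ⟨F, hF, hfF⟩ := hf
  obtain ⟨G, hG, hgG⟩ := hg
  exact ⟨F + G, hF.add hG, fun X => by simp [hfF, hgG]⟩

/-- The index of the entry `(i, α)` among the minors. -/
def entryIndex (i : Fin M) (α : Fin n) : MinorIndex M n :=
  ⟨⟨0, lt_min i.pos α.pos⟩, OrderEmbedding.ofStrictMono (fun _ => i) (Subsingleton.strictMono (α := Fin 1) _),
    OrderEmbedding.ofStrictMono (fun _ => α) (Subsingleton.strictMono (α := Fin 1) _)⟩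

lemma minors_entryIndex (X : Matrix (Fin M) (Fin n) ℝ) (i : Fin M) (α : Fin n) :
    minors X (entryIndex i α) = X i α := by
  simp only [minors]
  exact (Matrix.det_fin_one _).trans rfl

/-- The matrix of the entries of a vector of minors. -/
def entries : (MinorIndex M n → ℝ) →ₗ[ℝ] Matrix (Fin M) (Fin n) ℝ where
  toFun A := Matrix.of fun i α => A (entryIndex i α)
  map_add' _ _ := rfl
  map_smul' _ _ := rfl

lemma entries_minors (X : Matrix (Fin M) (Fin n) ℝ) : entries (minors X) = X := by
  ext i α
  exact minors_entryIndex X i α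

lemma polyconvex_of_convexOn {f : Matrix (Fin M) (Fin n) ℝ → ℝ} (hf : ConvexOn ℝ Set.univ f) :
    Polyconvex f :=
  ⟨f ∘ entries, hf.comp_linearMap entries, fun X => by simp [entries_minors]⟩

lemma polyconvex_const_mul_det (d : ℝ) (r : Fin 2 ↪o Fin M) (s : Fin 2 ↪o Fin n) :
    Polyconvex fun X => d * (X.submatrix r s).det := by
  have hM : 2 ≤ M := by simpa using Fintype.card_le_of_injective r r.injective
  have hn : 2 ≤ n := by simpa using Fintype.card_le_of_injective s s.injective
  refine ⟨fun A => d * A ⟨⟨1, lt_min hM hn⟩, r, s⟩, ⟨convex_univ, fun x _ y _ a b _ _ _ => ?_⟩,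
    fun X => rfl⟩
  simp only [Pi.add_apply, Pi.smul_apply, smul_eq_mul]
  exact le_of_eq (by ring)

end

section

variable {M n : ℕ}

/-- A strongly polyconvex function with value `c`, gradient `Y` and determinant coefficient `d`
at `X₀`, whose Hessian at `X₀` is positive definite. -/
def localModel (c : ℝ) (X₀ Y : Matrix (Fin M) (Fin n) ℝ) (d : ℝ) (r : Fin 2 ↪o Fin M)
    (s : Fin 2 ↪o Fin n) (τ : ℝ) (X : Matrix (Fin M) (Fin n) ℝ) : ℝ :=
  c + ∑ i, ∑ α, Y i α * (X i α - X₀ i α) + d * ((X - X₀).submatrix r s).det +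
    τ * ∑ i, ∑ α, (X i α - X₀ i α) ^ 2 + |d| * ∑ i, ∑ α, softSq τ (X i α - X₀ i α)

lemma convexOn_sum_entries {h : Fin M → Fin n → ℝ → ℝ}
    (hc : ∀ i α, ConvexOn ℝ Set.univ (h i α)) :
    ConvexOn ℝ Set.univ fun X : Matrix (Fin M) (Fin n) ℝ => ∑ i, ∑ α, h i α (X i α) := by
  refine ⟨convex_univ, fun x _ y _ a b ha hb hab => ?_⟩
  simp only [smul_eq_mul, Finset.mul_sum, ← Finset.sum_add_distrib]
  exact Finset.sum_le_sum fun i _ => Finset.sum_le_sum fun α _ =>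
    (hc i α).2 (Set.mem_univ (x i α)) (Set.mem_univ (y i α)) ha hb hab

lemma contDiff_entry (i : Fin M) (α : Fin n) :
    ContDiff ℝ ∞ fun X : Matrix (Fin M) (Fin n) ℝ => X i α :=
  (Matrix.entryLinearMap ℝ ℝ i α).toContinuousLinearMap.contDiff

section localModel

variable (c : ℝ) (X₀ Y : Matrix (Fin M) (Fin n) ℝ) (d : ℝ) (r : Fin 2 ↪o Fin M)
  (s : Fin 2 ↪o Fin n) {τ : ℝ}

/-- Modulo affine functions of `X`, `τ|X - X₀|²` is `τ|X|²` and the shifted minor is the minor of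
`X` itself, which is linear in the vector of minors. Only the convex `softSq` terms remain. -/
lemma polyconvex_localModel_sub (hτ : 0 < τ) :
    Polyconvex fun X => localModel c X₀ Y d r s τ X - τ * ∑ i, ∑ α, X i α ^ 2 := by
  have h1 : ConvexOn ℝ Set.univ fun X : Matrix (Fin M) (Fin n) ℝ => ∑ i, ∑ α,
      (Y i α * (X i α - X₀ i α) + τ * (X₀ i α ^ 2 - 2 * X i α * X₀ i α) +
        |d| * softSq τ (X i α - X₀ i α)) := by
    refine convexOn_sum_entries (h := fun i α x => Y i α * (x - X₀ i α) +
      τ * (X₀ i α ^ 2 - 2 * x * X₀ i α) + |d| * softSq τ (x - X₀ i α)) fun i α => ?_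
    refine ⟨convex_univ, fun x _ y _ a b ha hb hab => ?_⟩
    have := (convexOn_softSq hτ).2 (Set.mem_univ (x - X₀ i α)) (Set.mem_univ (y - X₀ i α)) ha hb hab
    have := mul_le_mul_of_nonneg_left this (abs_nonneg d)
    obtain rfl : b = 1 - a := by linarith
    simp only [smul_eq_mul] at this ⊢
    rw [show a * (x - X₀ i α) + (1 - a) * (y - X₀ i α) = a * x + (1 - a) * y - X₀ i α by ring]
      at this
    linarith
  have h2 : ConvexOn ℝ Set.univ fun X : Matrix (Fin M) (Fin n) ℝ =>
      c + d * (((X - X₀).submatrix r s).det - (X.submatrix r s).det) := by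
    refine ⟨convex_univ, fun x _ y _ a b ha hb hab => ?_⟩
    obtain rfl : b = 1 - a := by linarith
    refine le_of_eq ?_
    simp only [det_fin_two, submatrix_apply, Matrix.sub_apply, Matrix.add_apply,
      Matrix.smul_apply, smul_eq_mul]
    ring
  have h := (polyconvex_of_convexOn (h1.add h2)).add (polyconvex_const_mul_det d r s)
  convert h using 2 with X
  simp only [localModel, Pi.add_apply, Finset.sum_add_distrib, ← Finset.mul_sum]
  have e : ∑ i, ∑ α, (X i α - X₀ i α) ^ 2 =
      ∑ i, ∑ α, X i α ^ 2 + ∑ i, ∑ α, (X₀ i α ^ 2 - 2 * X i α * X₀ i α) := by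
    simp only [← Finset.sum_add_distrib]
    exact Finset.sum_congr rfl fun i _ => Finset.sum_congr rfl fun α _ => by ring
  rw [e]
  ring

lemma contDiff_localModel (hτ : 0 < τ) : ContDiff ℝ ∞ (localModel c X₀ Y d r s τ) := by
  have hs (i : Fin M) (α : Fin n) :
      ContDiff ℝ ∞ fun X : Matrix (Fin M) (Fin n) ℝ => X i α - X₀ i α :=
    (contDiff_entry i α).sub contDiff_const
  unfold localModel
  simp only [det_fin_two, submatrix_apply, Matrix.sub_apply]
  refine (((contDiff_const.add ?_).add (contDiff_const.mul ?_)).add (contDiff_const.mul ?_)).add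
    (contDiff_const.mul ?_)
  · exact ContDiff.sum fun i _ => ContDiff.sum fun α _ => contDiff_const.mul (hs i α)
  · exact ((hs _ _).mul (hs _ _)).sub ((hs _ _).mul (hs _ _))
  · exact ContDiff.sum fun i _ => ContDiff.sum fun α _ => (hs i α).pow 2
  · exact ContDiff.sum fun i _ => ContDiff.sum fun α _ => (contDiff_softSq hτ).comp (hs i α)

lemma localModel_self (hτ : 0 < τ) : localModel c X₀ Y d r s τ X₀ = c := by
  simp [localModel, softSq_zero_right hτ]

/-- Both added terms disappear as `τ → 0`, although the second derivative of `softSq τ` at `0` is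
`1` for every `τ > 0`. Thus the strict inequalities survive while the Hessian correction keeps its
size. -/
lemma tendsto_localModel (X : Matrix (Fin M) (Fin n) ℝ) :
    Tendsto (fun τ => localModel c X₀ Y d r s τ X) (𝓝[>] 0)
      (𝓝 (c + ∑ i, ∑ α, Y i α * (X i α - X₀ i α) + d * ((X - X₀).submatrix r s).det)) := by
  have hc : Continuous fun τ => localModel c X₀ Y d r s τ X := by
    unfold localModel softSq
    fun_prop
  have := (hc.tendsto 0).mono_left (nhdsWithin_le_nhds (s := Set.Ioi 0))
  simpa [localModel, softSq_zero_left] using this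

/-- The derivative of `localModel` along a line through `X₀`. -/
def localModelDeriv (Y : Matrix (Fin M) (Fin n) ℝ) (d : ℝ) (r : Fin 2 ↪o Fin M)
    (s : Fin 2 ↪o Fin n) (τ : ℝ) (H : Matrix (Fin M) (Fin n) ℝ) (t : ℝ) : ℝ :=
  ∑ i, ∑ α, Y i α * H i α + d * (2 * t * (H.submatrix r s).det) +
    τ * (2 * t * ∑ i, ∑ α, H i α ^ 2) + |d| * ∑ i, ∑ α, softSqDeriv τ (t * H i α) * H i α

lemma hasDerivAt_localModel (hτ : 0 < τ) (H : Matrix (Fin M) (Fin n) ℝ) (t : ℝ) :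
    HasDerivAt (fun t : ℝ => localModel c X₀ Y d r s τ (X₀ + t • H))
      (localModelDeriv Y d r s τ H t) t := by
  have e : (fun t : ℝ => localModel c X₀ Y d r s τ (X₀ + t • H)) = fun t =>
      c + t * ∑ i, ∑ α, Y i α * H i α + d * (t ^ 2 * (H.submatrix r s).det) +
        τ * (t ^ 2 * ∑ i, ∑ α, H i α ^ 2) + |d| * ∑ i, ∑ α, softSq τ (t * H i α) := by
    funext t
    simp only [localModel, add_sub_cancel_left, Matrix.add_apply, Matrix.smul_apply, smul_eq_mul,
      Finset.mul_sum, mul_pow, det_fin_two, submatrix_apply]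
    simp only [mul_left_comm t]
    ring
  rw [e]
  have hsum : HasDerivAt (fun t : ℝ => ∑ i, ∑ α, softSq τ (t * H i α))
      (∑ i, ∑ α, softSqDeriv τ (t * H i α) * H i α) t := by
    refine HasDerivAt.fun_sum fun i _ => HasDerivAt.fun_sum fun α _ => ?_
    have := (hasDerivAt_softSq hτ (t * H i α)).comp t ((hasDerivAt_id t).mul_const (H i α))
    simpa [Function.comp_def] using this
  have h2 := hasDerivAt_pow 2 t
  have h := ((((hasDerivAt_id t).mul_const (∑ i, ∑ α, Y i α * H i α)).const_add c).add
    ((h2.mul_const (H.submatrix r s).det).const_mul d)).add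
    ((h2.mul_const (∑ i, ∑ α, H i α ^ 2)).const_mul τ) |>.add (hsum.const_mul |d|)
  refine h.congr_deriv ?_
  simp [localModelDeriv]

lemma localModelDeriv_zero (H : Matrix (Fin M) (Fin n) ℝ) :
    localModelDeriv Y d r s τ H 0 = ∑ i, ∑ α, Y i α * H i α := by
  simp [localModelDeriv, softSqDeriv_zero]

lemma hasDerivAt_localModelDeriv (hτ : 0 < τ) (H : Matrix (Fin M) (Fin n) ℝ) :
    HasDerivAt (localModelDeriv Y d r s τ H)
      (2 * d * (H.submatrix r s).det + (2 * τ + |d|) * ∑ i, ∑ α, H i α ^ 2) 0 := by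
  have hsum : HasDerivAt (fun t : ℝ => ∑ i, ∑ α, softSqDeriv τ (t * H i α) * H i α)
      (∑ i, ∑ α, H i α ^ 2) 0 := by
    refine HasDerivAt.fun_sum fun i _ => HasDerivAt.fun_sum fun α _ => ?_
    have h0 : HasDerivAt (softSqDeriv τ) 1 (id 0 * H i α) := by
      rw [id, zero_mul]; exact hasDerivAt_softSqDeriv hτ
    have := (h0.comp (0 : ℝ) ((hasDerivAt_id (0 : ℝ)).mul_const (H i α))).mul_const (H i α)
    simpa [Function.comp_def, sq] using this
  have h2 : HasDerivAt (fun t : ℝ => 2 * t) 2 0 := by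
    simpa using (hasDerivAt_id (0 : ℝ)).const_mul 2
  have h := (((h2.mul_const (H.submatrix r s).det).const_mul d).const_add
    (∑ i, ∑ α, Y i α * H i α)).add ((h2.mul_const (∑ i, ∑ α, H i α ^ 2)).const_mul τ)
    |>.add (hsum.const_mul |d|)
  refine h.congr_deriv ?_
  ring

end localModel

lemma abs_two_mul_det_submatrix_le (r : Fin 2 ↪o Fin M) (s : Fin 2 ↪o Fin n)
    (H : Matrix (Fin M) (Fin n) ℝ) :
    |2 * (H.submatrix r s).det| ≤ ∑ i, ∑ α, H i α ^ 2 := by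
  have h1 : ∑ i : Fin 2, ∑ α : Fin 2, H (r i) (s α) ^ 2 ≤ ∑ i, ∑ α, H i α ^ 2 := by
    refine (Finset.sum_map Finset.univ r.toEmbedding
      fun i => ∑ α : Fin 2, H i (s α) ^ 2).symm.le.trans ?_
    refine (Finset.sum_le_univ_sum_of_nonneg fun i => by positivity).trans
      (Finset.sum_le_sum fun i _ => ?_)
    refine (Finset.sum_map Finset.univ s.toEmbedding fun α => H i α ^ 2).symm.le.trans ?_
    exact Finset.sum_le_univ_sum_of_nonneg fun α => by positivity
  refine le_trans ?_ h1
  simp only [Fin.sum_univ_two, det_fin_two, submatrix_apply]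
  rw [abs_le]
  constructor
  · nlinarith [sq_nonneg (H (r 0) (s 0) + H (r 1) (s 1)), sq_nonneg (H (r 0) (s 1) - H (r 1) (s 0))]
  · nlinarith [sq_nonneg (H (r 0) (s 0) - H (r 1) (s 1)), sq_nonneg (H (r 0) (s 1) + H (r 1) (s 0))]

lemma sum_sq_pos {H : Matrix (Fin M) (Fin n) ℝ} (hH : H ≠ 0) : 0 < ∑ i, ∑ α, H i α ^ 2 := by
  refine (Finset.sum_nonneg fun i _ => Finset.sum_nonneg fun α _ => sq_nonneg _).lt_of_ne' ?_
  intro h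
  refine hH (Matrix.ext fun i α => ?_)
  have := (Finset.sum_eq_zero_iff_of_nonneg fun i _ => Finset.sum_nonneg
    fun α _ => sq_nonneg _).mp h i (Finset.mem_univ i)
  have := (Finset.sum_eq_zero_iff_of_nonneg fun α _ => sq_nonneg _).mp this α (Finset.mem_univ α)
  simpa using this

/-- The first two derivatives of a smooth function along a line. -/
lemma fderiv_eq_of_hasDerivAt_line {E : Type*} [NormedAddCommGroup E] [NormedSpace ℝ E]
    {F : E → ℝ} (hF : ContDiff ℝ ∞ F) {X H : E} {g : ℝ → ℝ} {v : ℝ}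
    (hg : ∀ t, HasDerivAt (fun t : ℝ => F (X + t • H)) (g t) t) (hv : HasDerivAt g v 0) :
    fderiv ℝ F X H = g 0 ∧ fderiv ℝ (fderiv ℝ F) X H H = v := by
  have hline (t : ℝ) : HasDerivAt (fun t : ℝ => X + t • H) H t :=
    (((hasDerivAt_id t).smul_const H).const_add X).congr_deriv (one_smul ℝ H)
  have hF1 : Differentiable ℝ F := hF.differentiable (by simp)
  have hF2 : Differentiable ℝ (fderiv ℝ F) :=
    (hF.fderiv_right (m := 1) (by norm_cast)).differentiable (by simp)
  have e (t : ℝ) : fderiv ℝ F (X + t • H) H = g t :=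
    ((hF1 (X + t • H)).hasFDerivAt.comp_hasDerivAt t (hline t)).unique (hg t)
  have h2 : HasDerivAt (fun t : ℝ => fderiv ℝ F (X + t • H)) (fderiv ℝ (fderiv ℝ F) X H) 0 := by
    have h := (hF2 (X + (0 : ℝ) • H)).hasFDerivAt.comp_hasDerivAt (0 : ℝ) (hline 0)
    rwa [zero_smul, add_zero] at h
  have h3 : HasDerivAt (fun t : ℝ => fderiv ℝ F (X + t • H) H)
      (fderiv ℝ (fderiv ℝ F) X H H) 0 := by
    simpa using h2.clm_apply (hasDerivAt_const (0 : ℝ) H)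
  refine ⟨by simpa using e 0, ?_⟩
  simp only [e] at h3
  exact h3.unique hv

/-- Strict polyconvexity inequalities suffice for the existence of a smooth strongly polyconvex
function with prescribed gradients. -/
theorem exists_stronglyPolyconvex {ι : Type*} [Finite ι] [Nonempty ι]
    (c d : ι → ℝ) (X Y : ι → Matrix (Fin M) (Fin n) ℝ) (r : Fin 2 ↪o Fin M) (s : Fin 2 ↪o Fin n)
    (h : ∀ k l, k ≠ l → c k + ∑ i, ∑ α, Y k i α * (X l i α - X k i α) +
      d k * ((X l - X k).submatrix r s).det < c l) :
    ∃ F : Matrix (Fin M) (Fin n) ℝ → ℝ, ContDiff ℝ ∞ F ∧ StronglyPolyconvex F ∧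
      (∀ k i α, partialDeriv F (X k) i α = Y k i α) ∧ ∀ k, HessianPosDef F (X k) := by
  have := Fintype.ofFinite ι
  have ev : ∀ᶠ τ in 𝓝[>] (0 : ℝ), ∀ k l, k ≠ l →
      localModel (c k) (X k) (Y k) (d k) r s τ (X l) < c l := by
    simp only [Filter.eventually_all]
    intro k l hkl
    exact (tendsto_localModel _ _ _ _ _ _ _).eventually (gt_mem_nhds (h k l hkl))
  obtain ⟨τ, hτ, hτ0⟩ := (ev.and self_mem_nhdsWithin).exists
  have hτ0 : 0 < τ := hτ0
  have hQ : ContDiff ℝ ∞ fun X : Matrix (Fin M) (Fin n) ℝ => τ * ∑ i, ∑ α, X i α ^ 2 :=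
    contDiff_const.mul (ContDiff.sum fun i _ => ContDiff.sum fun α _ => (contDiff_entry i α).pow 2)
  have hs (k : ι) := contDiff_localModel (c k) (X k) (Y k) (d k) r s hτ0
  -- Gluing takes place after the common term `τ|Z|²` is removed: differences are unaffected, and
  -- restoring it gives strong polyconvexity with constant `τ`.
  obtain ⟨g, hgs, hgp, -, hg⟩ := exists_smooth_polyconvex_glue Finset.univ Finset.univ_nonempty
    (fun k Z => localModel (c k) (X k) (Y k) (d k) r s τ Z - τ * ∑ i, ∑ α, Z i α ^ 2) X
    (fun k => (hs k).sub hQ) (fun k => polyconvex_localModel_sub _ _ _ _ _ _ hτ0)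
    (fun k _ l _ hkl => by
      rw [localModel_self _ _ _ _ _ _ hτ0]
      exact sub_lt_sub_right (hτ k l hkl) _) 1 one_pos
  have hF : ContDiff ℝ ∞ fun Z => g Z + τ * ∑ i, ∑ α, Z i α ^ 2 := hgs.add hQ
  have hloc (k : ι) : (fun Z => g Z + τ * ∑ i, ∑ α, Z i α ^ 2) =ᶠ[𝓝 (X k)]
      localModel (c k) (X k) (Y k) (d k) r s τ := by
    filter_upwards [hg k (Finset.mem_univ k)] with Z hZ
    rw [hZ, sub_add_cancel]
  have hder (k : ι) (H : Matrix (Fin M) (Fin n) ℝ) := fderiv_eq_of_hasDerivAt_line (hs k)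
    (fun t => hasDerivAt_localModel (c k) (X k) (Y k) (d k) r s hτ0 H t)
    (hasDerivAt_localModelDeriv (Y k) (d k) r s hτ0 H)
  refine ⟨_, hF, ⟨τ, hτ0, ?_⟩, fun k i α => ?_, fun k H hH => ?_⟩
  · simpa only [add_sub_cancel_right] using hgp
  · rw [partialDeriv, (hloc k).fderiv_eq]
    refine (hder k _).1.trans ?_
    rw [localModelDeriv_zero]
    simp [Matrix.single_apply, Finset.sum_ite_eq, ite_and]
  · rw [(hloc k).fderiv.fderiv_eq]
    refine lt_of_lt_of_eq ?_ (hder k H).2.symm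
    -- The second derivative is `2 d det + (2 τ + |d|) |H|²`, hence at least `2 τ |H|²`.
    have h1 := abs_two_mul_det_submatrix_le r s H
    have h2 := sum_sq_pos hH
    have h3 := mul_le_mul_of_nonneg_left h1 (abs_nonneg (d k))
    rw [← abs_mul] at h3
    have h4 := neg_abs_le (d k * (2 * (H.submatrix r s).det))
    nlinarith [mul_pos hτ0 h2]

end

section

/-! ### Forms of degree `n - 1` in the span of `⋆dx^0` and `⋆dx^1` -/

open ExteriorAlgebra (ι)

variable {M p : ℕ}

/-- The form `dx^2 ∧ … ∧ dx^{n-1}`. -/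
def tailForm (p : ℕ) : Form (p + 2) p :=
  exteriorPower.ιMulti ℝ p fun j => dx j.succ.succ

lemma starDx_eq (α : Fin (p + 2)) :
    (starDx α : ExteriorAlgebra ℝ (Fin (p + 2) → ℝ)) =
      (-1 : ℝ) ^ (α : ℕ) • ExteriorAlgebra.ιMulti ℝ (p + 1) fun j => dx (α.succAbove j) := by
  have h : α.succAbove = (({α}ᶜ : Finset (Fin (p + 2))).orderEmbOfFin (card_compl_singleton α)) :=
    Finset.orderEmbOfFin_unique _ (fun j => by simp [Fin.succAbove_ne]) (Fin.strictMono_succAbove α)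
  rw [h]
  rfl

lemma tailForm_coe : (tailForm p : ExteriorAlgebra ℝ (Fin (p + 2) → ℝ)) =
    ExteriorAlgebra.ιMulti ℝ p fun j => dx j.succ.succ := rfl

lemma starDx_zero : (starDx (0 : Fin (p + 2)) : ExteriorAlgebra ℝ (Fin (p + 2) → ℝ)) =
    ι ℝ (dx 1) * (tailForm p : ExteriorAlgebra ℝ (Fin (p + 2) → ℝ)) := by
  rw [starDx_eq, ExteriorAlgebra.ιMulti_succ_apply, tailForm_coe]
  simp [Matrix.vecTail, Function.comp_def]

lemma starDx_one : (starDx (1 : Fin (p + 2)) : ExteriorAlgebra ℝ (Fin (p + 2) → ℝ)) =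
    -(ι ℝ (dx 0) * (tailForm p : ExteriorAlgebra ℝ (Fin (p + 2) → ℝ))) := by
  rw [starDx_eq, ExteriorAlgebra.ιMulti_succ_apply, tailForm_coe]
  have h (j : Fin p) : (1 : Fin (p + 2)).succAbove j.succ = j.succ.succ := by
    rw [← Fin.succ_zero_eq_one, Fin.succ_succAbove_succ, Fin.succAbove_zero]
  simp [Matrix.vecTail, Function.comp_def, h]

lemma ι_dx_mul_tailForm (j : Fin p) :
    ι ℝ (dx j.succ.succ) * (tailForm p : ExteriorAlgebra ℝ (Fin (p + 2) → ℝ)) = 0 := by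
  have h := ExteriorAlgebra.ιMulti_succ_apply (R := ℝ)
    (v := Fin.cons (dx j.succ.succ) fun j : Fin p => (dx j.succ.succ : Fin (p + 2) → ℝ))
  rw [AlternatingMap.map_eq_zero_of_eq (i := 0) (j := j.succ) _ _ (by simp) (Fin.succ_ne_zero j).symm]
    at h
  rw [tailForm_coe]
  exact h.symm

lemma ι_mul_tailForm (b : Fin (p + 2) → ℝ) :
    ι ℝ b * (tailForm p : ExteriorAlgebra ℝ (Fin (p + 2) → ℝ)) =
      b 0 • (ι ℝ (dx 0) * (tailForm p : ExteriorAlgebra ℝ (Fin (p + 2) → ℝ))) +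
      b 1 • (ι ℝ (dx 1) * (tailForm p : ExteriorAlgebra ℝ (Fin (p + 2) → ℝ))) := by
  have hb : b = ∑ α, b α • dx α := by
    simp only [dx]
    exact pi_eq_sum_univ' b |>.trans (Finset.sum_congr rfl fun i _ => by
      congr 1)
  conv_lhs => rw [hb]
  rw [Fin.sum_univ_succ, Fin.sum_univ_succ]
  simp [add_mul, Finset.sum_mul, ι_dx_mul_tailForm]

/-- The determinant, as an alternating map, takes the value `1` on the standard basis and so detects
this product. -/
lemma volume_ne_zero : ι ℝ (dx 0) * (ι ℝ (dx 1) *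
    (tailForm p : ExteriorAlgebra ℝ (Fin (p + 2) → ℝ))) ≠ 0 := by
  intro h
  have h1 : exteriorPower.ιMulti ℝ (p + 2) (fun α : Fin (p + 2) => dx α) = 0 := by
    apply Subtype.ext
    rw [exteriorPower.ιMulti_apply_coe, ExteriorAlgebra.ιMulti_succ_apply,
      ExteriorAlgebra.ιMulti_succ_apply]
    exact h
  have h2 := congrArg (exteriorPower.alternatingMapLinearEquiv
    (Matrix.detRowAlternating (n := Fin (p + 2)) (R := ℝ))) h1
  rw [exteriorPower.alternatingMapLinearEquiv_apply_ιMulti, map_zero] at h2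
  have h3 : (Matrix.of fun α : Fin (p + 2) => (dx α : Fin (p + 2) → ℝ)) = 1 := by
    ext i j
    simp [dx, Matrix.one_apply, Pi.single_apply, eq_comm]
  have h4 : (Matrix.of fun α : Fin (p + 2) => (dx α : Fin (p + 2) → ℝ)).det = 0 := h2
  rw [h3, Matrix.det_one] at h4
  exact one_ne_zero h4

lemma ι_mul_starDx_zero (b : Fin (p + 2) → ℝ) :
    ι ℝ b * (starDx (0 : Fin (p + 2)) : ExteriorAlgebra ℝ (Fin (p + 2) → ℝ)) =
      b 0 • (ι ℝ (dx 0) * (ι ℝ (dx 1) *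
        (tailForm p : ExteriorAlgebra ℝ (Fin (p + 2) → ℝ)))) := by
  have anti (u v : Fin (p + 2) → ℝ) : ι ℝ u * ι ℝ v = -(ι ℝ v * ι ℝ u) :=
    eq_neg_of_add_eq_zero_left (ExteriorAlgebra.ι_add_mul_swap u v)
  rw [starDx_zero, ← mul_assoc, anti, neg_mul, mul_assoc, ι_mul_tailForm, mul_add, mul_smul_comm,
    mul_smul_comm, ← mul_assoc, ← mul_assoc, ExteriorAlgebra.ι_sq_zero, anti (dx 1) (dx 0)]
  simp [mul_assoc]

lemma ι_mul_starDx_one (b : Fin (p + 2) → ℝ) :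
    ι ℝ b * (starDx (1 : Fin (p + 2)) : ExteriorAlgebra ℝ (Fin (p + 2) → ℝ)) =
      b 1 • (ι ℝ (dx 0) * (ι ℝ (dx 1) *
        (tailForm p : ExteriorAlgebra ℝ (Fin (p + 2) → ℝ)))) := by
  have anti (u v : Fin (p + 2) → ℝ) : ι ℝ u * ι ℝ v = -(ι ℝ v * ι ℝ u) :=
    eq_neg_of_add_eq_zero_left (ExteriorAlgebra.ι_add_mul_swap u v)
  rw [starDx_one, mul_neg, ← mul_assoc, anti, neg_mul, mul_assoc, ι_mul_tailForm, mul_add,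
    mul_smul_comm, mul_smul_comm, ← mul_assoc, ← mul_assoc, ExteriorAlgebra.ι_sq_zero]
  simp [mul_assoc]

/-! ### Elements of `𝓡` in terms of coefficient matrices. -/

/-- The pair of forms with given coefficient matrices. -/
def formPair (M n : ℕ) :
    (Matrix (Fin M) (Fin n) ℝ × Matrix (Fin M) (Fin n) ℝ) →ₗ[ℝ] FormPair M n where
  toFun Z := (fun i => (exteriorPower.oneEquiv ℝ (Fin n → ℝ)).symm (Z.1 i),
    fun i => ∑ α, Z.2 i α • starDx α)
  map_add' Z W := by
    ext i : 2
    · exact map_add (exteriorPower.oneEquiv ℝ (Fin n → ℝ)).symm (Z.1 i) (W.1 i)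
    · simp [add_smul, Finset.sum_add_distrib]
  map_smul' t Z := by
    ext i : 2
    · exact map_smul (exteriorPower.oneEquiv ℝ (Fin n → ℝ)).symm t (Z.1 i)
    · simp [Finset.smul_sum, mul_smul]

lemma toMatrix_formPair {n : ℕ} (Z : Matrix (Fin M) (Fin n) ℝ × Matrix (Fin M) (Fin n) ℝ) :
    toMatrix (formPair M n Z).1 = Z.1 := by
  ext i α
  simp [toMatrix, formPair]

lemma formPair_fst_coe {n : ℕ} (Z : Matrix (Fin M) (Fin n) ℝ × Matrix (Fin M) (Fin n) ℝ)
    (i : Fin M) : ((formPair M n Z).1 i : ExteriorAlgebra ℝ (Fin n → ℝ)) = ι ℝ (Z.1 i) := by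
  have h : (exteriorPower.oneEquiv ℝ (Fin n → ℝ)).symm (Z.1 i) =
      exteriorPower.ιMulti ℝ 1 fun _ => Z.1 i := by
    rw [LinearEquiv.symm_apply_eq, exteriorPower.oneEquiv_ιMulti]
  change (((exteriorPower.oneEquiv ℝ (Fin n → ℝ)).symm (Z.1 i) : Form n 1) :
    ExteriorAlgebra ℝ (Fin n → ℝ)) = _
  rw [h, exteriorPower.ιMulti_apply_coe, ExteriorAlgebra.ιMulti_apply]
  simp

/-- The vector which starts with the coordinates of `v` and continues with zeros. -/
def pad (v : Fin 2 → ℝ) : Fin (p + 2) → ℝ := vecCons (v 0) (vecCons (v 1) 0)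

lemma pad_zero (v : Fin 2 → ℝ) : (pad v : Fin (p + 2) → ℝ) 0 = v 0 := rfl

lemma pad_one (v : Fin 2 → ℝ) : (pad v : Fin (p + 2) → ℝ) 1 = v 1 := rfl

lemma pad_succ_succ (v : Fin 2 → ℝ) (j : Fin p) : pad v j.succ.succ = 0 := rfl

/-- Wedging with `tailForm` sees only the first two coordinates of `b`: `b ∧ tail = b₁ ⋆dx⁰ - b₀
⋆dx¹`. This is where the rotated lower right factors come from. -/
lemma isWedge_formPair (a w : Fin M → ℝ) (b : Fin (p + 2) → ℝ) :
    IsWedge (formPair M (p + 2) (vecMulVec a b, vecMulVec w (pad ![-b 1, b 0]))) b a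
      (fun i => -w i • tailForm p) := by
  refine ⟨fun i => ?_, fun i => ?_⟩
  · rw [formPair_fst_coe, ← Algebra.commutes, ← Algebra.smul_def, ← map_smul]
    rfl
  · simp only [formPair, LinearMap.coe_mk, AddHom.coe_mk, Fin.sum_univ_succ (n := p + 1),
      Fin.sum_univ_succ (n := p), vecMulVec_apply, pad_zero, Fin.succ_zero_eq_one, pad_one,
      pad_succ_succ]
    simp
    rw [starDx_zero, starDx_one, ι_mul_tailForm b]
    module

lemma IsWedge.entry_eq {n : ℕ} {Z : Matrix (Fin M) (Fin n) ℝ × Matrix (Fin M) (Fin n) ℝ}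
    {b : Fin n → ℝ} {a' : Fin M → ℝ} {a'' : Fin M → Form n (n - 2)}
    (h : IsWedge (formPair M n Z) b a' a'') (i : Fin M) (α : Fin n) : Z.1 i α = a' i * b α := by
  have h1 := h.1 i
  rw [formPair_fst_coe, ← Algebra.commutes, ← Algebra.smul_def, ← map_smul] at h1
  exact congrFun (ExteriorAlgebra.ι_leftInverse.injective h1) α

/-- Wedging the lower component with `b` once more gives zero, and `b ∧ ⋆dx^α` is `b α` times the
volume form. -/
lemma IsWedge.mul_add_mul_eq_zero
    {Z : Matrix (Fin M) (Fin (p + 2)) ℝ × Matrix (Fin M) (Fin (p + 2)) ℝ}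
    (hZ : ∀ i (α : Fin p), Z.2 i α.succ.succ = 0)
    {b : Fin (p + 2) → ℝ} {a' : Fin M → ℝ} {a'' : Fin M → Form (p + 2) (p + 2 - 2)}
    (h : IsWedge (formPair M (p + 2) Z) b a' a'') (i : Fin M) :
    Z.2 i 0 * b 0 + Z.2 i 1 * b 1 = 0 := by
  have h1 := congrArg (ι ℝ b * ·) (h.2 i)
  simp only [← mul_assoc, ExteriorAlgebra.ι_sq_zero, zero_mul] at h1
  simp only [formPair, LinearMap.coe_mk, AddHom.coe_mk, Fin.sum_univ_succ (n := p + 1),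
    Fin.sum_univ_succ (n := p), Fin.succ_zero_eq_one, hZ, zero_smul, Finset.sum_const_zero,
    add_zero] at h1
  have h2 : (Z.2 i 0 * b 0 + Z.2 i 1 * b 1) • (ι ℝ (dx 0) * (ι ℝ (dx 1) *
      (tailForm p : ExteriorAlgebra ℝ (Fin (p + 2) → ℝ)))) = 0 := by
    rw [← h1, add_smul, mul_smul, mul_smul, ← ι_mul_starDx_zero, ← ι_mul_starDx_one]
    simp [mul_add]
  exact (smul_eq_zero.mp h2).resolve_right volume_ne_zero

/-- The factors of an element of `𝓡°` are unique up to a scalar. -/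
lemma IsWedge.exists_smul_eq {a : Fin M → ℝ} {n : ℕ} {Y : Matrix (Fin M) (Fin n) ℝ}
    {b b' : Fin n → ℝ} {a' : Fin M → ℝ} {a'' : Fin M → Form n (n - 2)} (ha : a ≠ 0) (hb : b ≠ 0)
    (ha' : a' ≠ 0) (h : IsWedge (formPair M n (vecMulVec a b, Y)) b' a' a'') :
    ∃ t : ℝ, t ≠ 0 ∧ b' = t • b ∧ a' = t⁻¹ • a := by
  have e (i : Fin M) (α : Fin n) : a i * b α = a' i * b' α := h.entry_eq i α
  obtain ⟨i, hi⟩ := Function.ne_iff.mp ha'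
  obtain ⟨β, hβ⟩ := Function.ne_iff.mp hb
  simp only [Pi.zero_apply] at hi hβ
  have hb' : b' = (a i / a' i) • b := by
    ext α
    rw [Pi.smul_apply, smul_eq_mul, div_mul_eq_mul_div, e, mul_div_cancel_left₀ _ hi]
  have haa (j : Fin M) : a j = a i / a' i * a' j := by
    have := e j β
    rw [hb', Pi.smul_apply, smul_eq_mul] at this
    exact mul_right_cancel₀ hβ (this.trans (by ring))
  have ht : a i / a' i ≠ 0 := by
    intro h0
    exact ha (funext fun j => by rw [haa j, h0, zero_mul, Pi.zero_apply])
  refine ⟨a i / a' i, ht, hb', ?_⟩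
  ext j
  rw [Pi.smul_apply, smul_eq_mul, haa j, inv_mul_cancel_left₀ ht]

end

/-! ### Lifting planar configurations to `M × n` matrices -/

lemma exists_linearIndependent_extension {K : Type*} [AddCommGroup K] [Module ℝ K]
    [FiniteDimensional ℝ K] {g : Fin 2 → K} (hg : LinearIndependent ℝ g) (p : ℕ)
    (hp : p + 2 ≤ Module.finrank ℝ K) :
    ∃ f : Fin (p + 2) → K, LinearIndependent ℝ f ∧ f 0 = g 0 ∧ f 1 = g 1 := by
  induction p with
  | zero => exact ⟨g, hg, rfl, rfl⟩
  | succ p ih =>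
    obtain ⟨f, hf, h0, h1⟩ := ih (by omega)
    obtain ⟨x, hx⟩ := exists_linearIndependent_snoc_of_lt_finrank hf (by omega)
    refine ⟨Fin.snoc f x, hx, ?_, ?_⟩
    · rw [← h0]
      exact Fin.snoc_castSucc (α := fun _ => K) x f 0
    · rw [← h1]
      exact Fin.snoc_castSucc (α := fun _ => K) x f 1

/-- Right factors in `ℝ^n` which extend those of a planar configuration and are not contained in
any hyperplane. -/
structure Extension {m : ℕ} (T : PlanarConfig m) (p : ℕ) where
  b : ℕ → Fin (p + 2) → ℝ
  b_zero : ∀ j ≤ m, b j 0 = T.b j 0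
  b_one : ∀ j ≤ m, b j 1 = T.b j 1
  sum_eq_zero : ∀ i α, ∑ j ∈ Finset.range (m + 1), T.a j i * b j α = 0
  eq_zero : ∀ c : Fin (p + 2) → ℝ, (∀ j ≤ m, ∑ α, c α * b j α = 0) → c = 0

/-- Each coordinate of the right factors must be a linear relation among the `m + 1` planar vectors
`a j`. These relations form a space of dimension at least `m - 1 ≥ p + 2`, and the two planar
coordinates are independent in it because `b 0`, `b 1` is a basis, so they extend to `p + 2`
independent relations. -/
lemma Extension.nonempty {m : ℕ} (T : PlanarConfig m) {p : ℕ} (hm : p + 3 ≤ m) :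
    Nonempty (Extension T p) := by
  let A : Matrix (Fin 2) (Fin (m + 1)) ℝ := Matrix.of fun i j => T.a j i
  have hmem (f : ℕ → ℝ) (hf : ∀ i, ∑ j ∈ Finset.range (m + 1), T.a j i * f j = 0) :
      (fun j : Fin (m + 1) => f j) ∈ LinearMap.ker A.mulVecLin := by
    rw [LinearMap.mem_ker]
    ext i
    rw [Pi.zero_apply, ← hf i, ← Fin.sum_univ_eq_sum_range (fun j => T.a j i * f j)]
    rfl
  have hs (i α : Fin 2) : ∑ j ∈ Finset.range (m + 1), T.a j i * T.b j α = 0 := by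
    have := congrFun (congrFun T.sum_a i) α
    simpa [Matrix.sum_apply, vecMulVec_apply] using this
  let g : Fin 2 → LinearMap.ker A.mulVecLin :=
    fun α => ⟨_, hmem (fun j => T.b j α) fun i => hs i α⟩
  have hg : LinearIndependent ℝ g := by
    rw [Fintype.linearIndependent_iff]
    intro c hc
    rw [Fin.sum_univ_two] at hc
    have hc (j : Fin (m + 1)) : c 0 * T.b j 0 + c 1 * T.b j 1 = 0 :=
      congrFun (congrArg Subtype.val hc) j
    have h0 := hc ⟨0, by omega⟩
    have h1 := hc ⟨1, by omega⟩
    simp [T.b_zero] at h0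
    simp [T.b_one] at h1
    intro i
    fin_cases i
    · exact h0
    · exact h1
  have hrank := A.mulVecLin.finrank_range_add_finrank_ker
  have hrange := Submodule.finrank_le (LinearMap.range A.mulVecLin)
  rw [Module.finrank_fin_fun] at hrange hrank
  obtain ⟨f, hf, hf0, hf1⟩ := exists_linearIndependent_extension hg p (by omega)
  have hf' : LinearIndependent ℝ fun α => (f α : Fin (m + 1) → ℝ) :=
    hf.map' (LinearMap.ker A.mulVecLin).subtype (Submodule.ker_subtype _)
  let b : ℕ → Fin (p + 2) → ℝ := fun j α =>
    if h : j < m + 1 then (f α : Fin (m + 1) → ℝ) ⟨j, h⟩ else 0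
  have hb (j : Fin (m + 1)) (α : Fin (p + 2)) : b j α = (f α : Fin (m + 1) → ℝ) j :=
    dif_pos j.2
  refine ⟨⟨b, fun j hj => ?_, fun j hj => ?_, fun i α => ?_, fun c hc => ?_⟩⟩
  · rw [hb ⟨j, Nat.lt_succ_of_le hj⟩, hf0]
  · rw [hb ⟨j, Nat.lt_succ_of_le hj⟩, hf1]
  · rw [← Fin.sum_univ_eq_sum_range (fun j => T.a j i * b j α)]
    simp only [hb]
    exact congrFun (LinearMap.mem_ker.mp (f α).2) i
  · refine funext fun α => Fintype.linearIndependent_iff.mp hf' c (funext fun j => ?_) α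
    have := hc j (Nat.lt_succ_iff.mp j.2)
    simpa [hb] using this

lemma linearIndependent_pair_of_cross_ne_zero {n : ℕ} {u v : Fin (n + 2) → ℝ}
    (h : u 0 * v 1 - u 1 * v 0 ≠ 0) : LinearIndependent ℝ ![u, v] := by
  rw [LinearIndependent.pair_iff]
  intro s t hst
  have h0 : s * u 0 + t * v 0 = 0 := congrFun hst 0
  have h1 : s * u 1 + t * v 1 = 0 := congrFun hst 1
  constructor
  · exact (mul_eq_zero.mp (show s * (u 0 * v 1 - u 1 * v 0) = 0 by
      linear_combination v 1 * h0 - v 0 * h1)).resolve_right h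
  · exact (mul_eq_zero.mp (show t * (u 0 * v 1 - u 1 * v 0) = 0 by
      linear_combination u 0 * h1 - u 1 * h0)).resolve_right h

lemma linearIndependent_pair_smul {V : Type*} [AddCommGroup V] [Module ℝ V] {u v : V} {s t : ℝ}
    (hs : s ≠ 0) (ht : t ≠ 0) (h : LinearIndependent ℝ ![u, v]) :
    LinearIndependent ℝ ![s • u, t • v] := by
  rw [LinearIndependent.pair_iff] at h ⊢
  intro x y hxy
  rw [smul_smul, smul_smul] at hxy
  have := h _ _ hxy
  exact ⟨(mul_eq_zero.mp this.1).resolve_right hs, (mul_eq_zero.mp this.2).resolve_right ht⟩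

lemma gap_add_gap (c d c' d' : ℝ) (X Y X' Y' : Matrix (Fin 2) (Fin 2) ℝ) :
    gap c d X Y c' X' + gap c' d' X' Y' c X =
      pairing (Y' - Y) (X' - X) - (d + d') * (X' - X).det := by
  simp [gap_eq, pairing, Fin.sum_univ_two, det_fin_two]
  ring

lemma sum_Iio_val {A : Type*} [AddCommMonoid A] {N : ℕ} (k : Fin N) (f : ℕ → A) :
    ∑ j ∈ Finset.Iio k, f j = ∑ j ∈ Finset.range k, f j := by
  rw [← Nat.Iio_eq_range, ← Fin.map_valEmbedding_Iio, Finset.sum_map]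
  rfl

/-! ### The lifted configuration: inequalities, non-degeneracy, wildness. -/

namespace Extension

variable {m : ℕ} {T : PlanarConfig m} {p q : ℕ}

/-- The edges of the lifted configuration. -/
def edge (q : ℕ) (S : Extension T p) (j : ℕ) :
    Matrix (Fin (q + 2)) (Fin (p + 2)) ℝ × Matrix (Fin (q + 2)) (Fin (p + 2)) ℝ :=
  (vecMulVec (pad (T.a j)) (S.b j), vecMulVec (pad (T.w j)) (pad ![-S.b j 1, S.b j 0]))

/-- The upper endpoints of the lifted configuration. -/
def upper (q : ℕ) (S : Extension T p) (k : ℕ) : Matrix (Fin (q + 2)) (Fin (p + 2)) ℝ :=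
  corner T.κ (fun j => pad (T.a j)) S.b k

/-- The lower endpoints of the lifted configuration. -/
def lower (q : ℕ) (S : Extension T p) (k : ℕ) : Matrix (Fin (q + 2)) (Fin (p + 2)) ℝ :=
  corner T.κ (fun j => pad (T.w j)) (fun j => pad ![-S.b j 1, S.b j 0]) k

variable (S : Extension T p)

lemma sum_edge : ∑ j ∈ Finset.range (m + 1), S.edge q j = 0 := by
  refine Prod.ext ?_ ?_
  · rw [Prod.fst_sum]
    ext i α
    rw [Matrix.sum_apply, Prod.fst_zero, Matrix.zero_apply]
    simp only [edge, vecMulVec_apply]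
    refine Fin.cases ?_ (fun i => ?_) i
    · exact S.sum_eq_zero 0 α
    · refine Fin.cases ?_ (fun i => ?_) i
      · exact S.sum_eq_zero 1 α
      · simp [pad_succ_succ]
  · rw [Prod.snd_sum]
    have hs (i α : Fin 2) : ∑ j ∈ Finset.range (m + 1), T.w j i * T.b j α = 0 := by
      have := congrFun (congrFun T.sum_w i) α
      simpa [Matrix.sum_apply, vecMulVec_apply] using this
    have h0 (i : Fin 2) : ∑ j ∈ Finset.range (m + 1), T.w j i * S.b j 0 = 0 := by
      rw [← hs i 0]
      exact Finset.sum_congr rfl fun j hj => by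
        rw [S.b_zero j (Nat.lt_succ_iff.mp (Finset.mem_range.mp hj))]
    have h1 (i : Fin 2) : ∑ j ∈ Finset.range (m + 1), T.w j i * -S.b j 1 = 0 := by
      simp only [mul_neg, Finset.sum_neg_distrib, neg_eq_zero]
      rw [← hs i 1]
      exact Finset.sum_congr rfl fun j hj => by
        rw [S.b_one j (Nat.lt_succ_iff.mp (Finset.mem_range.mp hj))]
    ext i α
    rw [Matrix.sum_apply, Prod.snd_zero, Matrix.zero_apply]
    simp only [edge, vecMulVec_apply]
    have key (i : Fin 2) :
        ∑ j ∈ Finset.range (m + 1), T.w j i * (pad ![-S.b j 1, S.b j 0] : Fin (p + 2) → ℝ) α = 0 := by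
      refine Fin.cases ?_ (fun α => ?_) α
      · exact h1 i
      · refine Fin.cases ?_ (fun α => ?_) α
        · exact h0 i
        · simp [pad_succ_succ]
    refine Fin.cases (key 0) (fun i => ?_) i
    refine Fin.cases (key 1) (fun i => ?_) i
    simp [pad_succ_succ]

/-- The lifted configuration. -/
def config (q : ℕ) (S : Extension T p) : TConfig (q + 2) (p + 2) (m + 1) where
  P := 0
  C j := formPair (q + 2) (p + 2) (S.edge q j)
  κ j := T.κ j
  mem_setR j := ⟨_, _, _, isWedge_formPair (pad (T.a j)) (pad (T.w j)) (S.b j)⟩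
  sum_eq_zero := by
    rw [← map_sum, Fin.sum_univ_eq_sum_range (S.edge q), sum_edge, map_zero]
  one_lt j := T.one_lt j (Nat.lt_succ_iff.mp j.2)

lemma endpoint_config (k : Fin (m + 1)) :
    (S.config q).endpoint k = formPair (q + 2) (p + 2) (S.upper q k, S.lower q k) := by
  simp only [TConfig.endpoint, config, zero_add]
  rw [← map_sum, ← map_smul, ← map_add, sum_Iio_val k (S.edge q)]
  congr 1
  refine Prod.ext ?_ ?_
  · simp [Prod.fst_sum, edge, upper, corner]
  · simp [Prod.snd_sum, edge, lower, corner]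

lemma endMatrix_config (k : Fin (m + 1)) : (S.config q).endMatrix k = S.upper q k := by
  rw [TConfig.endMatrix, endpoint_config, toMatrix_formPair]

/-- The embedding of the first two indices. -/
def firstTwo (q : ℕ) : Fin 2 ↪o Fin (q + 2) := Fin.castLEOrderEmb (Nat.le_add_left 2 q)

lemma upper_submatrix {k : ℕ} (hk : k ≤ m) :
    (S.upper q k).submatrix (firstTwo q) (firstTwo p) = corner T.κ T.a T.b k := by
  have h : (S.upper q k).submatrix (firstTwo q) (firstTwo p) =
      corner T.κ T.a (fun j α => S.b j (firstTwo p α)) k := by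
    ext i α
    simp only [upper, submatrix_apply, corner_apply]
    fin_cases i <;> rfl
  rw [h]
  refine PlanarConfig.corner_congr rfl (fun _ _ => rfl) fun j hj => funext fun α => ?_
  fin_cases α
  · exact S.b_zero j (hj.trans hk)
  · exact S.b_one j (hj.trans hk)

lemma lower_submatrix {k : ℕ} (hk : k ≤ m) :
    (S.lower q k).submatrix (firstTwo q) (firstTwo p) =
      corner T.κ T.w (fun j => perp (T.b j)) k := by
  have h : (S.lower q k).submatrix (firstTwo q) (firstTwo p) =
      corner T.κ T.w (fun j => ![-S.b j 1, S.b j 0]) k := by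
    ext i α
    simp only [lower, submatrix_apply, corner_apply]
    fin_cases i <;> fin_cases α <;> rfl
  rw [h]
  refine PlanarConfig.corner_congr rfl (fun _ _ => rfl) fun j hj => ?_
  rw [S.b_zero j (hj.trans hk), S.b_one j (hj.trans hk)]
  rfl

lemma lower_row (k : ℕ) (i : Fin q) (α : Fin (p + 2)) : S.lower q k i.succ.succ α = 0 := by
  simp [lower, corner_apply, pad_succ_succ]

lemma lower_col (k : ℕ) (i : Fin (q + 2)) (α : Fin p) : S.lower q k i α.succ.succ = 0 := by
  simp [lower, corner_apply, pad_succ_succ]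

lemma sum_mul_eq_pairing {Y X : Matrix (Fin (q + 2)) (Fin (p + 2)) ℝ}
    (hr : ∀ (i : Fin q) α, Y i.succ.succ α = 0) (hc : ∀ i (α : Fin p), Y i α.succ.succ = 0) :
    ∑ i, ∑ α, Y i α * X i α = pairing (Y.submatrix (firstTwo q) (firstTwo p))
      (X.submatrix (firstTwo q) (firstTwo p)) := by
  simp only [Fin.sum_univ_succ (n := q + 1), Fin.sum_univ_succ (n := q),
    Fin.sum_univ_succ (n := p + 1), Fin.sum_univ_succ (n := p), hr, hc, zero_mul,
    Finset.sum_const_zero, add_zero, pairing, Fin.sum_univ_two]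
  rfl

lemma interpolation_lt {k l : ℕ} (hk : k ≤ m) (hl : l ≤ m) (hkl : k ≠ l) :
    T.c k + ∑ i, ∑ α, S.lower q k i α * (S.upper q l i α - S.upper q k i α) +
      T.d k * ((S.upper q l - S.upper q k).submatrix (firstTwo q) (firstTwo p)).det < T.c l := by
  have h := T.gap_pos k hk l hl hkl
  have e := sum_mul_eq_pairing (X := S.upper q l - S.upper q k) (S.lower_row k) (S.lower_col k)
  simp only [Matrix.sub_apply] at e
  rw [e, submatrix_sub, Pi.sub_apply, Pi.sub_apply, S.upper_submatrix hk, S.upper_submatrix hl,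
    S.lower_submatrix hk]
  rw [gap] at h
  linarith

lemma cross_a_ne_zero (T : PlanarConfig m) (j : Fin (m + 1)) :
    cross (T.a j) (T.a (finRotate (m + 1) j)) ≠ 0 := by
  obtain ⟨j, hj⟩ := j
  rcases (Nat.lt_succ_iff.mp hj).lt_or_eq with h | rfl
  · rw [finRotate_of_lt h]
    exact T.cross_a j h
  · rw [finRotate_last']
    exact T.cross_a_last

lemma cross_b_ne_zero (j : Fin (m + 1)) :
    S.b j 0 * S.b (finRotate (m + 1) j) 1 - S.b j 1 * S.b (finRotate (m + 1) j) 0 ≠ 0 := by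
  rw [S.b_zero _ (Nat.lt_succ_iff.mp j.2), S.b_one _ (Nat.lt_succ_iff.mp j.2),
    S.b_zero _ (Nat.lt_succ_iff.mp (finRotate (m + 1) j).2),
    S.b_one _ (Nat.lt_succ_iff.mp (finRotate (m + 1) j).2)]
  obtain ⟨j, hj⟩ := j
  rcases (Nat.lt_succ_iff.mp hj).lt_or_eq with h | rfl
  · rw [finRotate_of_lt h]
    exact T.cross_b j h
  · rw [finRotate_last']
    exact T.cross_b_last

lemma b_ne_zero (j : Fin (m + 1)) : S.b j ≠ 0 := by
  intro h
  exact S.cross_b_ne_zero j (by simp [h])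

lemma pad_a_ne_zero (T : PlanarConfig m) (j : Fin (m + 1)) :
    (pad (T.a j) : Fin (q + 2) → ℝ) ≠ 0 := by
  intro h
  have h0 : T.a j 0 = 0 := congrFun h 0
  have h1 : T.a j 1 = 0 := congrFun h 1
  exact cross_a_ne_zero T j (by simp [cross, h0, h1])

lemma span_b_eq_top : Submodule.span ℝ (Set.range fun j : Fin (m + 1) => S.b j) = ⊤ := by
  by_contra hne
  obtain ⟨φ, hφ, hle⟩ := Submodule.exists_le_ker_of_lt_top _ (lt_top_iff_ne_top.mpr hne)
  have hφ' (x : Fin (p + 2) → ℝ) : φ x = ∑ α, φ (fun β => if α = β then 1 else 0) * x α := by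
    rw [LinearMap.pi_apply_eq_sum_univ φ x]
    exact Finset.sum_congr rfl fun α _ => mul_comm _ _
  have h0 := S.eq_zero (fun α => φ fun β => if α = β then 1 else 0) fun j hj => by
    rw [← hφ']
    exact hle (Submodule.subset_span ⟨⟨j, Nat.lt_succ_of_le hj⟩, rfl⟩)
  refine hφ (LinearMap.ext fun x => ?_)
  rw [hφ', LinearMap.zero_apply]
  exact Finset.sum_eq_zero fun α _ => by rw [show φ _ = 0 from congrFun h0 α, zero_mul]

/-- If the difference were in `𝓡`, its upper part would be `a' ⊗ b'`, with vanishing minor, and each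
lower row would be orthogonal to `b'` in the first two coordinates, so the pairing would vanish too.
Then the two strict gaps would add up to zero by `gap_add_gap`. -/
lemma endpoint_sub_notMem_setR {k l : Fin (m + 1)} (hkl : k ≠ l) :
    (S.config q).endpoint k - (S.config q).endpoint l ∉ setR (q + 2) (p + 2) := by
  rintro ⟨b', a', a'', h⟩
  rw [S.endpoint_config, S.endpoint_config, ← map_sub] at h
  have hX (i : Fin (q + 2)) (α : Fin (p + 2)) : S.upper q k i α - S.upper q l i α = a' i * b' α :=
    h.entry_eq i α
  have hY (i : Fin (q + 2)) : (S.lower q k i 0 - S.lower q l i 0) * b' 0 +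
      (S.lower q k i 1 - S.lower q l i 1) * b' 1 = 0 :=
    h.mul_add_mul_eq_zero (fun i α => by simp [lower_col]) i
  have hk := Nat.lt_succ_iff.mp k.2
  have hl := Nat.lt_succ_iff.mp l.2
  have hne := Fin.val_ne_of_ne hkl
  have hpos := add_pos (T.gap_pos l hl k hk hne.symm) (T.gap_pos k hk l hl hne)
  rw [gap_add_gap, ← S.upper_submatrix (q := q) hk, ← S.upper_submatrix (q := q) hl,
    ← S.lower_submatrix (q := q) hk, ← S.lower_submatrix (q := q) hl] at hpos
  simp only [pairing, Fin.sum_univ_two, det_fin_two, Matrix.sub_apply, submatrix_apply, hX] at hpos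
  have h0 : (firstTwo p 0) = 0 := rfl
  have h1 : (firstTwo p 1) = 1 := rfl
  rw [h0, h1] at hpos
  have e0 := hY (firstTwo q 0)
  have e1 := hY (firstTwo q 1)
  refine lt_irrefl _ (hpos.trans_eq ?_)
  linear_combination a' (firstTwo q 0) * e0 + a' (firstTwo q 1) * e1

lemma nonDegenerate : (S.config q).NonDegenerate where
  mem_setRo j := ⟨_, _, _, S.b_ne_zero j, pad_a_ne_zero T j,
    isWedge_formPair (pad (T.a j)) (pad (T.w j)) (S.b j)⟩
  span_and_indep b a' a'' _ ha' h := by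
    -- The conditions are required for every factorisation, but factors are unique up to nonzero
    -- scalars, which affect neither span nor independence.
    have hex (j : Fin (m + 1)) :=
      IsWedge.exists_smul_eq (pad_a_ne_zero T j) (S.b_ne_zero j) (ha' j) (h j)
    choose t ht hb ha using hex
    refine ⟨?_, fun j => ?_, fun j => ?_⟩
    · rw [eq_top_iff, ← S.span_b_eq_top, Submodule.span_le]
      rintro _ ⟨j, rfl⟩
      have : S.b j = (t j)⁻¹ • b j := by rw [hb j, inv_smul_smul₀ (ht j)]
      simp only [this]
      exact Submodule.smul_mem _ _ (Submodule.subset_span ⟨j, rfl⟩)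
    · rw [hb j, hb (finRotate _ j)]
      exact linearIndependent_pair_smul (ht _) (ht _)
        (linearIndependent_pair_of_cross_ne_zero (S.cross_b_ne_zero j))
    · rw [ha j, ha (finRotate _ j)]
      exact linearIndependent_pair_smul (inv_ne_zero (ht _)) (inv_ne_zero (ht _))
        (linearIndependent_pair_of_cross_ne_zero (cross_a_ne_zero T j))
  sub_notMem_setR _ _ hkl := S.endpoint_sub_notMem_setR hkl

/-- Column `β` of `X_{k+1} - X_k` is `(1 - κ_k) b_k^β a_k + κ_{k+1} b_{k+1}^β a_{k+1}` with `a_k`,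
`a_{k+1}` independent and both scalars `1 - κ_k`, `κ_{k+1}` nonzero. If all columns agreed, the
`β`-th coordinate of every right factor would vanish, against `eq_zero`. -/
lemma wild (hm : 0 < m) : (S.config q).Wild := by
  intro β
  by_contra! hall
  simp only [endMatrix_config] at hall
  have step (k : ℕ) (hk : k < m) : S.b k β = 0 ∧ S.b (k + 1) β = 0 := by
    have hX := hall ⟨k + 1, by omega⟩ ⟨k, by omega⟩
    have h0 : S.upper q (k + 1) 0 β = S.upper q k 0 β := congrFun hX 0
    have h1 : S.upper q (k + 1) 1 β = S.upper q k 1 β := congrFun hX 1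
    simp only [upper, corner_apply, Finset.sum_range_succ, pad_zero, pad_one] at h0 h1
    have hc := T.cross_a k hk
    have hκ := T.one_lt k hk.le
    have hκ' := T.one_lt (k + 1) hk
    have e0 : (1 - T.κ k) * S.b k β * cross (T.a k) (T.a (k + 1)) = 0 := by
      simp only [cross]
      linear_combination T.a (k + 1) 1 * h0 - T.a (k + 1) 0 * h1
    have e1 : T.κ (k + 1) * S.b (k + 1) β * cross (T.a k) (T.a (k + 1)) = 0 := by
      simp only [cross]
      linear_combination T.a k 0 * h1 - T.a k 1 * h0
    exact ⟨(mul_eq_zero.mp ((mul_eq_zero.mp e0).resolve_right hc)).resolve_left (by linarith),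
      (mul_eq_zero.mp ((mul_eq_zero.mp e1).resolve_right hc)).resolve_left (by linarith)⟩
  have hzero (j : ℕ) (hj : j ≤ m) : S.b j β = 0 := by
    rcases hj.lt_or_eq with h | rfl
    · exact (step j h).1
    · obtain ⟨k, rfl⟩ := Nat.exists_eq_add_of_le' hm
      exact (step k (by omega)).2
  have := congrFun (S.eq_zero (Pi.single β 1) fun j hj => by simp [Pi.single_apply, hzero j hj]) β
  simp at this

end Extension

end PolyconvexTN

end

open PolyconvexTN in
theorem mainTheorem5 (M n : ℕ) (hM : 2 ≤ M) (hn : 2 ≤ n) (N₀ : ℕ) :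
    ∃ N : ℕ, N₀ ≤ N ∧
      ∃ (F : Matrix (Fin M) (Fin n) ℝ → ℝ) (T : PolyconvexTN.TConfig M n N),
        ContDiff ℝ ∞ F ∧
        PolyconvexTN.StronglyPolyconvex F ∧
        T.NonDegenerate ∧
        T.Wild ∧
        (∀ k, T.endpoint k ∈ PolyconvexTN.setK F) ∧
        (∀ k, PolyconvexTN.HessianPosDef F (T.endMatrix k)) := by
  obtain ⟨q, rfl⟩ := Nat.exists_eq_add_of_le' hM
  obtain ⟨p, rfl⟩ := Nat.exists_eq_add_of_le' hn
  -- This `m` is at least `4`, where the induction starts, at least `p + 3`, as the extension needs,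
  -- and gives `N = m + 1 ≥ N₀`.
  obtain ⟨T⟩ := PlanarConfig.nonempty (m := N₀ + p + 4) (by omega)
  obtain ⟨S⟩ := Extension.nonempty T (p := p) (by omega)
  obtain ⟨F, hF, hFp, hFd, hFh⟩ := exists_stronglyPolyconvex (ι := Fin (N₀ + p + 4 + 1))
    (fun k => T.c k) (fun k => T.d k) (fun k => S.upper q k) (fun k => S.lower q k)
    (Extension.firstTwo q) (Extension.firstTwo p) fun k l hkl =>
      S.interpolation_lt (Nat.lt_succ_iff.mp k.2) (Nat.lt_succ_iff.mp l.2) (Fin.val_ne_of_ne hkl)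
  refine ⟨N₀ + p + 4 + 1, by omega, F, S.config q, hF, hFp, S.nonDegenerate, S.wild (by omega),
    fun k i => ?_, fun k => ?_⟩
  · rw [S.endpoint_config, toMatrix_formPair]
    simp only [hFd]
    rfl
  · rw [S.endMatrix_config]
    exact hFh k
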